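/- For a finite simple graph $G$ with nonempty vertex set and $k\ge 1$ let $G^k$ be its $k$-fold categorical (tensor) power: its vertices are the $k$-tuples of vertices of $G$, and $(x_1,\dots,x_k)$ and $(y_1,\dots,y_k)$ are adjacent if and only if $x_iy_i\in E(G)$ for every $i$. The tensor capacity of $G$ is $$\Theta^T(G)=\lim_{k\to\infty}\frac{\alpha(G^k)}{|V(G)|^k},$$ where $\alpha$ denotes the independence number. A splitgraph is a graph whose vertex set can be partitioned into an independent set $S$ and a clique $C$ (either of which may be empty). **Theorem.** There exists a polynomial-time algorithm to compute the tensor capacity for splitgraphs. That is, there are a single random access machine program (operating on natural numbers, with addition, truncated subtraction, indirect addressing and zero tests, each at unit cost) and a polynomial $p$ such that, for every splitgraph $G$ with vertices $0,\dots,n-1$, $n\ge 1$, given by $n$ and its adjacency matrix, the program halts after at most $p(n)$ steps and outputs natural numbers $a$ and $b\neq 0$ for which the limit $\Theta^T(G)$ exists and $\Theta^T(G)=a/b$. -/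

import Mathlib

open Filter Topology

/-! ### Splitgraphs, categorical powers and the tensor capacity -/

/-- A graph is a splitgraph if its vertices can be partitioned into an independent set `S`
and a clique `C`. -/
def SimpleGraph.IsSplitgraph {V : Type*} (G : SimpleGraph V) : Prop :=
  ∃ S C : Set V, IsCompl S C ∧ G.IsIndepSet S ∧ G.IsClique C

/-- The categorical (tensor) product of copies of `G` indexed by a nonempty type `ι`: two
vertices are adjacent iff they are adjacent in `G` in every coordinate. -/
def SimpleGraph.catPow {V : Type*} (G : SimpleGraph V) (ι : Type*) [Nonempty ι] :
    SimpleGraph (ι → V) where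
  Adj x y := ∀ i, G.Adj (x i) (y i)
  symm := ⟨fun _ _ h i => (h i).symm⟩
  loopless := ⟨fun _ h => (h (Classical.arbitrary ι)).ne rfl⟩

/-- The independence ratio `α(G) / |V(G)|`. -/
noncomputable def SimpleGraph.indepRatio {V : Type*} (G : SimpleGraph V) : ℝ :=
  (G.indepNum : ℝ) / (Nat.card V : ℝ)

/-- `G.HasTensorCapacity θ` says that the independence ratios of the categorical powers
`G¹, G², G³, …` converge and that their limit is `θ`. -/
def SimpleGraph.HasTensorCapacity {V : Type*} (G : SimpleGraph V) (θ : ℝ) : Prop :=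
  Tendsto (fun k : ℕ => (G.catPow (Fin (k + 1))).indepRatio) atTop (𝓝 θ)

/-! ### Random access machines with unit cost

The machine stores natural numbers in registers and in arrays; a program mentions only
finitely many registers and arrays.  The arithmetic instructions are addition and truncated
subtraction (there is no multiplication, so that numbers grow by at most one bit per step, and
polynomial time in this model is the usual polynomial time). -/

namespace RAM

/-- A memory state: `reg r` is the content of register `r`, and `arr a i` is the content of
cell `i` of array `a`. -/
structure State where
  reg : ℕ → ℕ
  arr : ℕ → ℕ → ℕ

/-- `σ.setReg r v`: write `v` to register `r`. -/
def State.setReg (σ : State) (r v : ℕ) : State :=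
  { σ with reg := Function.update σ.reg r v }

/-- `σ.setCell a i v`: write `v` to cell `i` of array `a`. -/
def State.setCell (σ : State) (a i v : ℕ) : State :=
  { σ with arr := Function.update σ.arr a (Function.update (σ.arr a) i v) }

/-- The elementary instructions. -/
inductive Instr where
  /-- `reg r := c` -/
  | const (r c : ℕ)
  /-- `reg r := reg x` -/
  | copy (r x : ℕ)
  /-- `reg r := reg x + reg y` -/
  | add (r x y : ℕ)
  /-- `reg r := max (reg x - reg y) 0` -/
  | sub (r x y : ℕ)
  /-- `reg r := arr a (reg x)` -/
  | load (r a x : ℕ)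
  /-- `arr a (reg x) := reg y` -/
  | store (a x y : ℕ)

/-- The effect of an elementary instruction. -/
def Instr.apply : Instr → State → State
  | const r c, σ => σ.setReg r c
  | copy r x, σ => σ.setReg r (σ.reg x)
  | add r x y, σ => σ.setReg r (σ.reg x + σ.reg y)
  | sub r x y, σ => σ.setReg r (σ.reg x - σ.reg y)
  | load r a x, σ => σ.setReg r (σ.arr a (σ.reg x))
  | store a x y, σ => σ.setCell a (σ.reg x) (σ.reg y)

/-- Programs, with the usual control structures; tests ask whether a register is nonzero. -/
inductive Program where
  | instr (I : Instr)
  | seq (P Q : Program)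
  | ite (r : ℕ) (P Q : Program)
  | while (r : ℕ) (P : Program)

/-- `Runs P σ t τ`: started in state `σ`, program `P` halts in state `τ` after exactly `t` steps.
Every elementary instruction and every evaluation of a test is one step. -/
inductive Runs : Program → State → ℕ → State → Prop
  | instr (I : Instr) (σ : State) : Runs (.instr I) σ 1 (I.apply σ)
  | seq {P Q : Program} {σ τ υ : State} {s t : ℕ} :
      Runs P σ s τ → Runs Q τ t υ → Runs (.seq P Q) σ (s + t) υ
  | iteTrue {r : ℕ} {P Q : Program} {σ τ : State} {t : ℕ} :
      σ.reg r ≠ 0 → Runs P σ t τ → Runs (.ite r P Q) σ (1 + t) τ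
  | iteFalse {r : ℕ} {P Q : Program} {σ τ : State} {t : ℕ} :
      σ.reg r = 0 → Runs Q σ t τ → Runs (.ite r P Q) σ (1 + t) τ
  | whileTrue {r : ℕ} {P : Program} {σ τ υ : State} {s t : ℕ} :
      σ.reg r ≠ 0 → Runs P σ s τ → Runs (.while r P) τ t υ → Runs (.while r P) σ (1 + s + t) υ
  | whileFalse {r : ℕ} {P : Program} {σ : State} :
      σ.reg r = 0 → Runs (.while r P) σ 1 σ

/-- The machine is deterministic: step count and final state are determined by the program
and the initial state. -/
theorem Runs.deterministic {P : Program} {σ τ τ' : State} {t t' : ℕ}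
    (h : Runs P σ t τ) (h' : Runs P σ t' τ') : t = t' ∧ τ = τ' := by
  induction h generalizing t' τ' with
  | instr I σ => cases h'; exact ⟨rfl, rfl⟩
  | seq _ _ ih₁ ih₂ =>
    cases h' with
    | seq a b =>
      obtain ⟨rfl, rfl⟩ := ih₁ a
      obtain ⟨rfl, rfl⟩ := ih₂ b
      exact ⟨rfl, rfl⟩
  | iteTrue h0 _ ih =>
    cases h' with
    | iteTrue _ a =>
      obtain ⟨rfl, rfl⟩ := ih a
      exact ⟨rfl, rfl⟩
    | iteFalse h1 _ => exact absurd h1 h0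
  | iteFalse h0 _ ih =>
    cases h' with
    | iteTrue h1 _ => exact absurd h0 h1
    | iteFalse _ a =>
      obtain ⟨rfl, rfl⟩ := ih a
      exact ⟨rfl, rfl⟩
  | whileTrue h0 _ _ ih₁ ih₂ =>
    cases h' with
    | whileTrue _ a b =>
      obtain ⟨rfl, rfl⟩ := ih₁ a
      obtain ⟨rfl, rfl⟩ := ih₂ b
      exact ⟨rfl, rfl⟩
    | whileFalse h1 => exact absurd h1 h0
  | whileFalse h0 =>
    cases h' with
    | whileTrue h1 _ _ => exact absurd h0 h1
    | whileFalse _ => exact ⟨rfl, rfl⟩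

open Classical in
/-- The initial state for an input graph with vertices `0, …, n - 1`: register `0` holds `n`,
array `0` holds the adjacency matrix row by row (entry `(i, j)` in cell `i * n + j`), and
everything else is `0`. -/
noncomputable def graphInput {n : ℕ} (G : SimpleGraph (Fin n)) : State where
  reg r := if r = 0 then n else 0
  arr a m := if a = 0 ∧ ∃ i j : Fin n, G.Adj i j ∧ m = i.val * n + j.val then 1 else 0

end RAM

/-! Let ρ be the maximum of |I| / |N[I]| over nonempty independent sets I, where N[I] is the closed
neighbourhood. The capacity is 1 if ρ > 1/2 and ρ otherwise. For the lower bound, the tuples whose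
first entry in N[I] lies in I form an independent set of density tending to |I| / |N[I]|. If |N(I)|
< |I|, a vertex weighting of mean below 1 whose product along every edge is at least 1 pushes the
density to 1 (`hasTensorCapacity_one`). For the upper bound with ρ ≤ 1/2, the bound on ρ reads p |J|
≤ q |N(J)| for independent J, with p ≥ q, and this survives tensor products (`Expanding.prod`).

It remains to compute ρ for a splitgraph whose partition is not given. Every vertex is simplicial or
cosimplicial. An independent set containing a cosimplicial v has ratio at most e / n, where e counts
the non-neighbours of v, and those non-neighbours are themselves an independent set of at least this
ratio. A set of simplicial vertices may be replaced by representatives, one for each class of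
adjacent simplicial vertices, without changing its size or closed neighbourhood. Any set of
representatives is independent.

Over sets of representatives the ratio is maximised by load balancing. Each representative spreads
n^3 tokens over its closed neighbourhood, and a token moves whenever the target load is smaller by
at least 2. The sum of squared loads starts at most n^7 and drops with every move. In a stable
position a gap between loads cuts off a set of heavy vertices, and the representatives with closed
neighbourhood inside it are optimal: rounding costs less than n^3
(`IsTokens.exists_heavyReps_ratio`).

Everything except the token loop is an expression with nested sums over 0, …, n - 1, which compiles
to a program of polynomial running time (`Expr.compile_runs`). -/

/-! ### Neighbourhoods and expansion of independent sets -/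

section Expansion

open Classical Finset

variable {V W : Type*} [Fintype V] [Fintype W]

/-- The set of all elements related to some element of `J`. -/
noncomputable def relNbhd (r : V → V → Prop) (J : Finset V) : Finset V :=
  univ.filter fun y => ∃ x ∈ J, r x y

theorem mem_relNbhd {r : V → V → Prop} {J : Finset V} {y : V} :
    y ∈ relNbhd r J ↔ ∃ x ∈ J, r x y := by
  simp [relNbhd]

theorem relNbhd_mono {r : V → V → Prop} {J K : Finset V} (h : J ⊆ K) :
    relNbhd r J ⊆ relNbhd r K := by
  intro y hy
  obtain ⟨x, hx, hxy⟩ := mem_relNbhd.1 hy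
  exact mem_relNbhd.2 ⟨x, h hx, hxy⟩

/-- Every `r`-independent set `J` satisfies `p |J| ≤ q |N(J)|`. -/
def Expanding (p q : ℕ) (r : V → V → Prop) : Prop :=
  ∀ J : Finset V, (∀ x ∈ J, ∀ y ∈ J, ¬ r x y) → p * #J ≤ q * #(relNbhd r J)

theorem Expanding.of_equiv {p q : ℕ} {r : V → V → Prop} {s : W → W → Prop} (e : V ≃ W)
    (h : Expanding p q r) (he : ∀ x y, s (e x) (e y) ↔ r x y) : Expanding p q s := by
  intro J hJ
  have h1 := h (J.map e.symm.toEmbedding) (by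
    intro x hx y hy
    simp only [mem_map_equiv, Equiv.symm_symm] at hx hy
    rw [← he]
    exact hJ _ hx _ hy)
  have h2 : relNbhd r (J.map e.symm.toEmbedding) = (relNbhd s J).map e.symm.toEmbedding := by
    ext y
    simp only [mem_map_equiv, Equiv.symm_symm, mem_relNbhd]
    constructor
    · rintro ⟨x, hx, hxy⟩
      exact ⟨e x, hx, (he _ _).2 hxy⟩
    · rintro ⟨x, hx, hxy⟩
      refine ⟨e.symm x, by simpa using hx, ?_⟩
      rw [← he]
      simpa using hxy
  rw [h2] at h1
  simpa using h1

theorem card_eq_sum_card_fiber (S : Finset (V × W)) :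
    #S = ∑ w, #(univ.filter fun v => (v, w) ∈ S) := by
  rw [Finset.card_eq_sum_card_fiberwise (f := Prod.snd) (t := univ) (by simp)]
  refine Finset.sum_congr rfl fun w _ => ?_
  refine Finset.card_bij (fun a _ => a.1) ?_ ?_ ?_
  · rintro ⟨a, b⟩ h
    simp only [mem_filter] at h
    obtain ⟨h, rfl⟩ := h
    simpa using h
  · rintro ⟨a, b⟩ h ⟨a', b'⟩ h' e
    simp only [mem_filter] at h h' e
    rw [e, h.2, h'.2]
  · intro v hv
    exact ⟨(v, w), by simpa using hv, rfl⟩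

/-- Expansion passes to a disjoint union of copies indexed by `W`. -/
theorem Expanding.prod_eq {p q : ℕ} {r : V → V → Prop} (h : Expanding p q r) :
    Expanding p q (fun a b : V × W => r a.1 b.1 ∧ a.2 = b.2) := by
  intro J hJ
  rw [card_eq_sum_card_fiber, card_eq_sum_card_fiber, mul_sum, mul_sum]
  refine Finset.sum_le_sum fun w _ => ?_
  refine (h _ ?_).trans (Nat.mul_le_mul_left _ (card_le_card ?_))
  · intro x hx y hy hxy
    simp only [mem_filter, mem_univ, true_and] at hx hy
    exact hJ _ hx _ hy ⟨hxy, rfl⟩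
  · intro y hy
    obtain ⟨x, hx, hxy⟩ := mem_relNbhd.1 hy
    simp only [mem_filter, mem_univ, true_and] at hx ⊢
    exact mem_relNbhd.2 ⟨_, hx, hxy, rfl⟩

/-- In an expanding relation, the part `K` of `S` with no neighbours in `S` expands by `p / q`,
and the rest of `S` does not shrink. -/
theorem Expanding.card_add_card_le [DecidableEq V] {p q : ℕ} {r : V → V → Prop} (h : Expanding p q r)
    (hr : ∀ x y, r x y → r y x) (hpq : q ≤ p) {S K : Finset V} (hKS : K ⊆ S)
    (hK : ∀ x ∈ K, ∀ y ∈ S, ¬ r x y) :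
    p * #K + q * #(S \ K) ≤ q * #(relNbhd r S) := by
  -- `S₀` is the part of `S` isolated within `S`. Then N(S₀) and S \ S₀ are disjoint parts of N(S),
  -- and q ≤ p allows passing from `S₀` to the smaller `K`.
  set S₀ := S.filter fun x => ∀ y ∈ S, ¬ r x y with hS₀
  have hKS₀ : K ⊆ S₀ := fun x hx => mem_filter.2 ⟨hKS hx, hK x hx⟩
  have hS₀S : S₀ ⊆ S := filter_subset _ _
  have h1 : p * #S₀ ≤ q * #(relNbhd r S₀) :=
    h S₀ fun x hx y hy => (mem_filter.1 hx).2 y (hS₀S hy)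
  have h2 : Disjoint (relNbhd r S₀) (S \ S₀) := by
    rw [disjoint_left]
    intro y hy hy'
    obtain ⟨x, hx, hxy⟩ := mem_relNbhd.1 hy
    exact (mem_filter.1 hx).2 y (mem_sdiff.1 hy').1 hxy
  have h3 : relNbhd r S₀ ∪ (S \ S₀) ⊆ relNbhd r S := by
    refine union_subset (relNbhd_mono hS₀S) fun x hx => ?_
    obtain ⟨hx, hx'⟩ := mem_sdiff.1 hx
    by_contra hn
    exact hx' (mem_filter.2 ⟨hx, fun y hy hxy => hn (mem_relNbhd.2 ⟨y, hy, hr _ _ hxy⟩)⟩)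
  have h4 := card_le_card h3
  rw [card_union_of_disjoint h2] at h4
  have h5 := card_sdiff_add_card_eq_card hS₀S
  have h6 := card_sdiff_add_card_eq_card hKS
  have h7 := card_le_card hKS₀
  obtain ⟨u, hu⟩ := Nat.exists_eq_add_of_le hpq
  obtain ⟨w, hw⟩ := Nat.exists_eq_add_of_le h7
  have h8 : #(S \ K) = w + #(S \ S₀) := by omega
  rw [h8]
  rw [hw] at h1
  subst hu
  nlinarith [Nat.mul_le_mul_left q h4, Nat.zero_le (u * w)]

/-- Expansion by a factor at least one passes to the tensor product of two relations. -/
theorem Expanding.prod {p q : ℕ} {r : V → V → Prop} {s : W → W → Prop} (h : Expanding p q r)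
    (h' : Expanding p q s) (hr : ∀ x y, r x y → r y x) (hs : ∀ x y, s x y → s y x)
    (hpq : q ≤ p) :
    Expanding p q (fun a b : V × W => r a.1 b.1 ∧ s a.2 b.2) := by
  intro I hI
  set r' : V × W → V × W → Prop := fun a b => r a.1 b.1 ∧ a.2 = b.2 with hr'
  set s' : V × W → V × W → Prop := fun a b => s a.2 b.2 ∧ a.1 = b.1 with hs'
  have hEr : Expanding p q r' := h.prod_eq
  have hEs : Expanding p q s' :=
    Expanding.of_equiv (Equiv.prodComm W V) (h'.prod_eq (W := V)) fun x y => by simp [hs']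
  -- A step in the tensor product is an `s'`-step followed by an `r'`-step; `S` is the set of
  -- midpoints. The points of `I` outside `S` expand into `S`, those inside `S` expand out of `S`.
  set S := relNbhd s' I with hS
  have h0 : p * #(I \ S) ≤ q * #(relNbhd s' (I \ S)) := by
    refine hEs _ fun x hx y hy hxy => ?_
    exact (mem_sdiff.1 hy).2 (mem_relNbhd.2 ⟨x, (mem_sdiff.1 hx).1, hxy⟩)
  have h1 : relNbhd s' (I \ S) ⊆ S \ (I ∩ S) := by
    intro y hy
    refine mem_sdiff.2 ⟨relNbhd_mono sdiff_subset hy, fun hy' => ?_⟩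
    obtain ⟨x, hx, hxy⟩ := mem_relNbhd.1 hy
    exact (mem_sdiff.1 hx).2
      (mem_relNbhd.2 ⟨y, (mem_inter.1 hy').1, hs _ _ hxy.1, hxy.2.symm⟩)
  -- If x in I ∩ S had an `r'`-neighbour y in `S`, reached from z in `I` by an `s'`-step, then x and
  -- z would be related in the product.
  have h2 : p * #(I ∩ S) + q * #(S \ (I ∩ S)) ≤ q * #(relNbhd r' S) := by
    refine hEr.card_add_card_le (fun x y hxy => ⟨hr _ _ hxy.1, hxy.2.symm⟩) hpq
      inter_subset_right fun x hx y hy hxy => ?_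
    obtain ⟨z, hz, hzy⟩ := mem_relNbhd.1 hy
    refine hI x (mem_inter.1 hx).1 z hz ⟨?_, ?_⟩
    · rw [hzy.2]
      exact hxy.1
    · rw [hxy.2]
      exact hs _ _ hzy.1
  have h3 : relNbhd r' S ⊆ relNbhd (fun a b : V × W => r a.1 b.1 ∧ s a.2 b.2) I := by
    intro y hy
    obtain ⟨z, hz, hzy⟩ := mem_relNbhd.1 hy
    obtain ⟨x, hx, hxz⟩ := mem_relNbhd.1 hz
    refine mem_relNbhd.2 ⟨x, hx, ?_, ?_⟩
    · rw [hxz.2]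
      exact hzy.1
    · rw [← hzy.2]
      exact hxz.1
  have h4 := card_sdiff_add_card_inter I S
  have h5 := Nat.mul_le_mul_left q (card_le_card h1)
  have h6 := Nat.mul_le_mul_left q (card_le_card h3)
  rw [← h4, mul_add]
  omega

theorem Expanding.pow {p q : ℕ} {r : V → V → Prop} (h : Expanding p q r)
    (hr : ∀ x y, r x y → r y x) (hpq : q ≤ p) (k : ℕ) :
    Expanding p q (fun x y : Fin k → V => ∀ i, r (x i) (y i)) := by
  induction k with
  | zero =>
    intro J hJ
    have : J = ∅ := by
      -- The empty tuple is related to itself, the condition being vacuous.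
      rw [eq_empty_iff_forall_notMem]
      exact fun x hx => hJ x hx x hx fun i => i.elim0
    simp [this]
  | succ k ih =>
    refine Expanding.of_equiv (Fin.consEquiv fun _ => V)
      (h.prod ih hr (fun x y hxy i => hr _ _ (hxy i)) hpq) fun x y => ?_
    simp [Fin.consEquiv, Fin.forall_fin_succ]

end Expansion

/-! ### The tensor capacity from the extremal ratio `|I| / |N[I]|` -/

namespace SimpleGraph

open Classical Finset

variable {V : Type*} [Fintype V] (G : SimpleGraph V)

/-- The closed neighbourhood of a set of vertices. -/
noncomputable def closedNbhd (J : Finset V) : Finset V :=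
  univ.filter fun y => ∃ x ∈ J, x = y ∨ G.Adj x y

variable {G}

theorem mem_closedNbhd {J : Finset V} {y : V} :
    y ∈ G.closedNbhd J ↔ ∃ x ∈ J, x = y ∨ G.Adj x y := by
  simp [closedNbhd]

theorem subset_closedNbhd (J : Finset V) : J ⊆ G.closedNbhd J :=
  fun x hx => mem_closedNbhd.2 ⟨x, hx, Or.inl rfl⟩

theorem card_closedNbhd {J : Finset V} (hJ : G.IsIndepSet J) :
    #(G.closedNbhd J) = #J + #(relNbhd G.Adj J) := by
  rw [← Finset.card_union_of_disjoint]
  · congr 1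
    ext y
    simp only [mem_closedNbhd, mem_union, mem_relNbhd]
    constructor
    · rintro ⟨x, hx, rfl | h⟩
      · exact Or.inl hx
      · exact Or.inr ⟨x, hx, h⟩
    · rintro (h | ⟨x, hx, h⟩)
      · exact ⟨y, h, Or.inl rfl⟩
      · exact ⟨x, hx, Or.inr h⟩
  · rw [Finset.disjoint_left]
    intro y hy hy'
    obtain ⟨x, hx, hxy⟩ := mem_relNbhd.1 hy'
    exact hJ hx hy hxy.ne hxy

theorem IsIndepSet.not_adj {V : Type*} {G : SimpleGraph V} {J : Finset V} (hJ : G.IsIndepSet J) {x y : V} (hx : x ∈ J)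
    (hy : y ∈ J) : ¬ G.Adj x y := fun h => hJ hx hy h.ne h

theorem isIndepSet_of_not_adj {V : Type*} {G : SimpleGraph V} {J : Finset V} (h : ∀ x ∈ J, ∀ y ∈ J, ¬ G.Adj x y) :
    G.IsIndepSet J := fun x hx y hy _ => h x hx y hy

/-- Since |N[J]| = |J| + |N(J)| for independent J, the hypothesis is expansion by (b - a) / a, a
factor at least 1 because 2a ≤ b. It passes to the power, where N[J] has at most |V|^(k+1) elements.
-/
theorem indepRatio_catPow_le {a b : ℕ} (hb : b ≠ 0) (hab : 2 * a ≤ b)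
    (h : ∀ J : Finset V, G.IsIndepSet J → #J * b ≤ a * #(G.closedNbhd J)) (k : ℕ) :
    (G.catPow (Fin (k + 1))).indepRatio ≤ (a : ℝ) / b := by
  have hE : Expanding (b - a) a G.Adj := by
    intro J hJ
    have hJ' := isIndepSet_of_not_adj hJ
    have h1 := h J hJ'
    rw [card_closedNbhd hJ'] at h1
    obtain ⟨c, rfl⟩ := Nat.exists_eq_add_of_le (show a ≤ b by omega)
    rw [Nat.add_sub_cancel_left]
    nlinarith
  have hP := hE.pow (fun x y => G.symm.symm x y) (by omega) (k + 1)
  obtain ⟨J, hJ⟩ := (G.catPow (Fin (k + 1))).exists_isNIndepSet_indepNum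
  have h2 := hP J fun x hx y hy => hJ.isIndepSet.not_adj hx hy
  have h3 := card_le_univ ((G.catPow (Fin (k + 1))).closedNbhd J)
  rw [card_closedNbhd hJ.isIndepSet] at h3
  have h4 : #J * b ≤ a * Fintype.card (Fin (k + 1) → V) := by
    refine le_trans ?_ (Nat.mul_le_mul_left a h3)
    obtain ⟨c, rfl⟩ := Nat.exists_eq_add_of_le (show a ≤ b by omega)
    rw [Nat.add_sub_cancel_left] at h2
    have h5 : #(relNbhd (fun x y : Fin (k + 1) → V => ∀ i, G.Adj (x i) (y i)) J) =
      #(relNbhd (G.catPow (Fin (k + 1))).Adj J) := rfl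
    rw [h5] at h2
    nlinarith
  rw [indepRatio, ← hJ.card_eq, Nat.card_eq_fintype_card]
  rcases Nat.eq_zero_or_pos (Fintype.card (Fin (k + 1) → V)) with h0 | h0
  -- Without vertices the ratio is 0 / 0 = 0.
  · rw [h0]
    simp
    positivity
  · rw [div_le_div_iff₀ (by exact_mod_cast h0) (by positivity)]
    exact_mod_cast h4

theorem indepRatio_le_one {V : Type*} [Finite V] (G : SimpleGraph V) : G.indepRatio ≤ 1 := by
  have := Fintype.ofFinite V
  obtain ⟨J, hJ⟩ := G.exists_isNIndepSet_indepNum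
  rw [indepRatio, ← hJ.card_eq, Nat.card_eq_fintype_card]
  exact div_le_one_of_le₀ (by exact_mod_cast card_le_univ J) (by positivity)

theorem le_indepRatio {V : Type*} [Fintype V] {G : SimpleGraph V} {J : Finset V}
    (hJ : G.IsIndepSet J) : (#J : ℝ) / Fintype.card V ≤ G.indepRatio := by
  rw [indepRatio, Nat.card_eq_fintype_card]
  have := hJ.card_le_indepNum
  gcongr

/-! ### Lower bounds on the capacity -/

/-- The tuples whose first entry in `K` exists and lies in `I`. -/
def FirstHit (I K : Finset V) : ∀ k : ℕ, (Fin k → V) → Prop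
  | 0, _ => False
  | k + 1, x => x 0 ∈ I ∨ (x 0 ∉ K ∧ FirstHit I K k (Fin.tail x))

/-- Of two adjacent tuples, look at the first coordinate where either hits `I`. The other entry is a
neighbour of `I`, so it lies in N[I] and must be in `I` as well, contradicting independence. -/
theorem FirstHit.not_adj {I : Finset V} (hI : G.IsIndepSet I) {k : ℕ} {x y : Fin k → V}
    (hx : FirstHit I (G.closedNbhd I) k x) (hy : FirstHit I (G.closedNbhd I) k y) :
    ¬ ∀ i, G.Adj (x i) (y i) := by
  induction k with
  | zero => exact hx.elim
  | succ k ih =>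
    intro h
    rcases hx with hx | ⟨hx, hx'⟩
    · rcases hy with hy | ⟨hy, hy'⟩
      · exact hI.not_adj hx hy (h 0)
      · exact hy (mem_closedNbhd.2 ⟨_, hx, Or.inr (h 0)⟩)
    · rcases hy with hy | ⟨hy, hy'⟩
      · exact hx (mem_closedNbhd.2 ⟨_, hy, Or.inr (h 0).symm⟩)
      · exact ih hx' hy' fun i => h i.succ

theorem card_firstHit_succ {I K : Finset V} (hIK : I ⊆ K) (k : ℕ) :
    #(univ.filter (FirstHit I K (k + 1))) =
      #I * Fintype.card V ^ k + #(Kᶜ) * #(univ.filter (FirstHit I K k)) := by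
  have h1 : univ.filter (FirstHit I K (k + 1)) =
      (I ×ˢ (univ : Finset (Fin k → V)) ∪ Kᶜ ×ˢ univ.filter (FirstHit I K k)).map
        (Fin.consEquiv fun _ => V).toEmbedding := by
    ext x
    simp only [mem_filter, mem_univ, true_and, mem_map_equiv, mem_union, mem_product,
      mem_compl]
    simp [Fin.consEquiv, FirstHit]
  rw [h1, card_map, card_union_of_disjoint, card_product, card_product]
  · simp
  · rw [Finset.disjoint_left]
    rintro ⟨a, b⟩ h h'
    simp only [mem_product, mem_compl] at h h'
    exact h'.1 (hIK h.1)

/-- The recurrence in `k` sums to a geometric series with quotient 1 - |K| / |V|. -/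
theorem card_firstHit {I K : Finset V} (hIK : I ⊆ K) (hI : I.Nonempty) (k : ℕ) :
    (#(univ.filter (FirstHit I K k)) : ℝ) / (Fintype.card V : ℝ) ^ k =
      (#I / #K : ℝ) * (1 - (1 - #K / Fintype.card V : ℝ) ^ k) := by
  have hK : (#K : ℝ) ≠ 0 := by
    have := (hI.mono hIK).card_pos
    positivity
  have : Nonempty V := hI.to_type
  have hV : (Fintype.card V : ℝ) ≠ 0 := by
    have := Fintype.card_pos (α := V)
    positivity
  induction k with
  | zero => simp [FirstHit]
  | succ k ih =>
    have hc : (#(Kᶜ) : ℝ) = Fintype.card V - #K := by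
      rw [card_compl, Nat.cast_sub (card_le_univ K)]
    rw [div_eq_iff (by positivity)] at ih
    rw [card_firstHit_succ hIK]
    push_cast
    rw [ih, hc, div_eq_iff (by positivity)]
    have hq : (Fintype.card V : ℝ) - #K = (1 - #K / Fintype.card V : ℝ) * Fintype.card V := by
      field_simp
    rw [hq]
    generalize (1 - (#K : ℝ) / Fintype.card V) = u at *
    have hu : (#K : ℝ) = (1 - u) * Fintype.card V := by linarith
    have h2 : (#I : ℝ) = (#I / #K : ℝ) * ((1 - u) * Fintype.card V) := by
      rw [← hu]
      field_simp
    nth_rewrite 1 [h2]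
    ring

theorem le_indepRatio_catPow {I : Finset V} (hI : G.IsIndepSet I) (hne : I.Nonempty) (k : ℕ) :
    (#I / #(G.closedNbhd I) : ℝ) *
      (1 - (1 - #(G.closedNbhd I) / Fintype.card V : ℝ) ^ (k + 1)) ≤
      (G.catPow (Fin (k + 1))).indepRatio := by
  rw [← card_firstHit (subset_closedNbhd I) hne]
  have h : (G.catPow (Fin (k + 1))).IsIndepSet
      (univ.filter (FirstHit I (G.closedNbhd I) (k + 1)) : Finset (Fin (k + 1) → V)) := by
    refine isIndepSet_of_not_adj fun x hx y hy => ?_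
    exact FirstHit.not_adj hI (mem_filter.1 hx).2 (mem_filter.1 hy).2
  refine le_trans (le_of_eq ?_) (le_indepRatio h)
  simp

theorem hasTensorCapacity_of_le_half {a b : ℕ} (hb : b ≠ 0) (hab : 2 * a ≤ b)
    (h : ∀ J : Finset V, G.IsIndepSet J → #J * b ≤ a * #(G.closedNbhd J))
    {I : Finset V} (hI : G.IsIndepSet I) (hne : I.Nonempty)
    (hIab : a * #(G.closedNbhd I) ≤ #I * b) : G.HasTensorCapacity ((a : ℝ) / b) := by
  have : Nonempty V := hne.to_type
  have hV : (0 : ℝ) < Fintype.card V := by exact_mod_cast Fintype.card_pos (α := V)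
  have hK : (0 : ℝ) < #(G.closedNbhd I) := by
    exact_mod_cast (hne.mono (subset_closedNbhd I)).card_pos
  have hb' : (0 : ℝ) < b := by positivity
  set u : ℝ := 1 - #(G.closedNbhd I) / Fintype.card V with hu
  have hu1 : u < 1 := by
    have : (0 : ℝ) < #(G.closedNbhd I) / Fintype.card V := by positivity
    linarith
  have hu0 : 0 ≤ u := by
    have : (#(G.closedNbhd I) : ℝ) / Fintype.card V ≤ 1 :=
      div_le_one_of_le₀ (by exact_mod_cast card_le_univ _) hV.le
    linarith
  have hlim : Tendsto (fun k : ℕ => (a / b : ℝ) * (1 - u ^ (k + 1))) atTop (𝓝 (a / b : ℝ)) := by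
    have h1 := (tendsto_add_atTop_iff_nat 1).2 (tendsto_pow_atTop_nhds_zero_of_lt_one hu0 hu1)
    simpa using (h1.const_sub 1).const_mul (a / b : ℝ)
  refine tendsto_of_tendsto_of_tendsto_of_le_of_le hlim tendsto_const_nhds (fun k => ?_)
    (fun k => indepRatio_catPow_le hb hab h k)
  refine le_trans ?_ (le_indepRatio_catPow hI hne k)
  refine mul_le_mul_of_nonneg_right ?_ (sub_nonneg.2 (pow_le_one₀ hu0 hu1.le))
  rw [div_le_div_iff₀ hb' hK]
  exact_mod_cast hIab

/-- The hypothesis says |N(I)| < |I|. Tuples whose product of weights is below 1 form an independent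
set, and by Markov's inequality they are almost all tuples once the mean weight is below 1. -/
theorem hasTensorCapacity_one {I : Finset V} (hI : G.IsIndepSet I)
    (hlt : #(G.closedNbhd I) < 2 * #I) : G.HasTensorCapacity 1 := by
  set N := relNbhd G.Adj I with hN
  rw [card_closedNbhd hI, ← hN] at hlt
  have hI0 : (0 : ℝ) < #I := by
    have : 0 < #I := by omega
    exact_mod_cast this
  have hNI : (#N : ℝ) < #I := by
    have : #N < #I := by omega
    exact_mod_cast this
  have hne : I.Nonempty := card_pos.1 (by omega)
  have : Nonempty V := hne.to_type
  have hV : (0 : ℝ) < Fintype.card V := by exact_mod_cast Fintype.card_pos (α := V)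
  have hdisj : ∀ v ∈ N, v ∉ I := by
    intro v hv hv'
    obtain ⟨x, hx, hxv⟩ := mem_relNbhd.1 hv
    exact hI.not_adj hx hv' hxv
  obtain ⟨z, hz0, hz1, hzN⟩ : ∃ z : ℝ, 0 < z ∧ z < 1 ∧ #N < z * #I := by
    -- The mean of |N| / |I| and 1.
    refine ⟨(#N + #I) / (2 * #I), by positivity, ?_, ?_⟩
    · rw [div_lt_one (by positivity)]
      linarith
    · have : ((#N + #I : ℝ) / (2 * #I)) * #I = (#N + #I) / 2 := by field_simp
      rw [this]
      linarith
  set g : V → ℝ := fun v => if v ∈ I then z else if v ∈ N then z⁻¹ else 1 with hg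
  have hzi : 1 < z⁻¹ := (one_lt_inv₀ hz0).2 hz1
  have hg0 : ∀ v, 0 < g v := by
    intro v
    simp only [hg]
    split_ifs <;> positivity
  have hgz : ∀ v, z ≤ g v := by
    intro v
    simp only [hg]
    split_ifs <;> linarith
  have hgadj : ∀ v w, G.Adj v w → 1 ≤ g v * g w := by
    have key : ∀ v w, G.Adj v w → v ∈ I → 1 ≤ g v * g w := by
      intro v w hvw hv
      have hw : w ∈ N := mem_relNbhd.2 ⟨v, hv, hvw⟩
      have : g v * g w = 1 := by
        simp only [hg, hv, hw, hdisj w hw, if_true, if_false]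
        exact mul_inv_cancel₀ hz0.ne'
      exact this.ge
    intro v w hvw
    by_cases hv : v ∈ I
    · exact key v w hvw hv
    by_cases hw : w ∈ I
    · rw [mul_comm]
      exact key w v hvw.symm hw
    have h1 : ∀ u, u ∉ I → 1 ≤ g u := by
      intro u hu
      simp only [hg, hu, if_false]
      split_ifs <;> linarith
    nlinarith [h1 v hv, h1 w hw]
  have hsum : ∑ v, g v < Fintype.card V := by
    have h1 : ∀ v, g v = 1 + (if v ∈ I then z - 1 else 0) + (if v ∈ N then z⁻¹ - 1 else 0) := by
      intro v
      simp only [hg]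
      by_cases hv : v ∈ I
      · have : v ∉ N := fun h => hdisj v h hv
        simp [hv, this]
      · by_cases hv' : v ∈ N <;> simp [hv, hv']
    simp_rw [h1]
    rw [sum_add_distrib, sum_add_distrib]
    simp only [sum_ite_mem, univ_inter, sum_const, card_univ, nsmul_eq_mul, mul_one]
    -- The total weight is |V| - |I| (1 - z) + |N| (1/z - 1), and |N| < z |I|.
    have h2 : (#N : ℝ) * (z⁻¹ - 1) < z * #I * (z⁻¹ - 1) :=
      mul_lt_mul_of_pos_right hzN (by linarith)
    have h3 : z * (#I : ℝ) * (z⁻¹ - 1) = #I * (1 - z) := by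
      field_simp
    linarith
  set ρ : ℝ := (∑ v, g v) / Fintype.card V with hρ
  have hρ0 : 0 ≤ ρ := div_nonneg (sum_nonneg fun v _ => (hg0 v).le) hV.le
  have hρ1 : ρ < 1 := (div_lt_one hV).2 hsum
  have hlim : Tendsto (fun k : ℕ => 1 - ρ ^ (k + 1)) atTop (𝓝 1) := by
    have h1 := (tendsto_add_atTop_iff_nat 1).2 (tendsto_pow_atTop_nhds_zero_of_lt_one hρ0 hρ1)
    simpa using h1.const_sub 1
  refine tendsto_of_tendsto_of_tendsto_of_le_of_le hlim tendsto_const_nhds (fun k => ?_)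
    (fun k => indepRatio_le_one _)
  set F : Finset (Fin (k + 1) → V) := univ.filter fun x => ∏ i, g (x i) < 1 with hF
  have hFi : (G.catPow (Fin (k + 1))).IsIndepSet F := by
    refine isIndepSet_of_not_adj fun x hx y hy hxy => ?_
    have hx' := (mem_filter.1 hx).2
    have hy' := (mem_filter.1 hy).2
    have h1 : (1 : ℝ) ≤ ∏ i, (g (x i) * g (y i)) :=
      Finset.one_le_prod fun i _ => hgadj _ _ (hxy i)
    rw [prod_mul_distrib] at h1
    have h2 : 0 < ∏ i, g (x i) := prod_pos fun i _ => hg0 _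
    have h3 : 0 < ∏ i, g (y i) := prod_pos fun i _ => hg0 _
    nlinarith
  refine le_trans ?_ (le_indepRatio hFi)
  -- Each tuple outside `F` contributes at least 1 to the expansion of (∑ g)^(k+1).
  have hFc : (#(Fᶜ) : ℝ) ≤ (∑ v, g v) ^ (k + 1) := by
    rw [Fintype.sum_pow, card_eq_sum_ones]
    push_cast
    refine (sum_le_sum (f := fun _ => (1 : ℝ)) (g := fun x => ∏ i, g (x i)) fun x hx => ?_).trans
      (sum_le_sum_of_subset_of_nonneg (subset_univ _) fun x _ _ =>
        (prod_pos fun i _ => hg0 _).le)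
    simpa [hF] using hx
  have hcard : (#F : ℝ) + #(Fᶜ) = (Fintype.card V : ℝ) ^ (k + 1) := by
    have := card_add_card_compl F
    rw [Fintype.card_fun, Fintype.card_fin] at this
    exact_mod_cast this
  rw [Fintype.card_fun, Fintype.card_fin, le_div_iff₀ (by positivity), hρ, div_pow, sub_mul,
    Nat.cast_pow, div_mul_cancel₀ _ (by positivity)]
  linarith

end SimpleGraph

/-! ### Expressions with bounded sums, compiled to the random access machine -/

namespace RAM

/-- Expressions over a memory state.  In `sum x e` the register `x` is bound and ranges over the
numbers below the content of register `0`. -/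
inductive Expr where
  | const (c : ℕ)
  | var (x : ℕ)
  | add (e f : Expr)
  | sub (e f : Expr)
  | load (a : ℕ) (e : Expr)
  | ite (c e f : Expr)
  | sum (x : ℕ) (e : Expr)

namespace Expr

/-- The value of an expression. -/
def eval : Expr → State → ℕ
  | const c, _ => c
  | var x, σ => σ.reg x
  | add e f, σ => eval e σ + eval f σ
  | sub e f, σ => eval e σ - eval f σ
  | load a e, σ => σ.arr a (eval e σ)
  | ite c e f, σ => if eval c σ ≠ 0 then eval e σ else eval f σ
  | sum x e, σ => ∑ i ∈ Finset.range (σ.reg 0), eval e (σ.setReg x i)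

/-- All registers occurring in the expression are below `d`, and register `0` is not bound. -/
def fits (d : ℕ) : Expr → Bool
  | const _ => true
  | var x => decide (x < d)
  | add e f => fits d e && fits d f
  | sub e f => fits d e && fits d f
  | load _ e => fits d e
  | ite c e f => fits d c && fits d e && fits d f
  | sum x e => decide (x ≠ 0) && decide (x < d) && fits d e

/-- A program evaluating the expression into register `d`, with scratch registers above `d`. -/
def compile : Expr → ℕ → Program
  | const c, d => .instr (.const d c)
  | var x, d => .instr (.copy d x)
  | add e f, d => .seq (compile e d) (.seq (compile f (d + 1)) (.instr (.add d d (d + 1))))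
  | sub e f, d => .seq (compile e d) (.seq (compile f (d + 1)) (.instr (.sub d d (d + 1))))
  | load a e, d => .seq (compile e d) (.instr (.load d a d))
  | ite c e f, d => .seq (compile c d) (.ite d (compile e d) (compile f d))
  | sum x e, d =>
    .seq (.instr (.copy (d + 1) x)) <| .seq (.instr (.const d 0)) <|
    .seq (.instr (.const x 0)) <| .seq (.instr (.copy (d + 2) 0)) <|
    .seq (.while (d + 2) <|
      .seq (compile e (d + 3)) <| .seq (.instr (.add d d (d + 3))) <|
      .seq (.instr (.const (d + 3) 1)) <| .seq (.instr (.add x x (d + 3)))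
        (.instr (.sub (d + 2) (d + 2) (d + 3)))) <|
    .instr (.copy x (d + 1))

/-- A bound on the running time of the compiled expression, in terms of register `0`. -/
noncomputable def cost : Expr → Polynomial ℕ
  | const _ => 1
  | var _ => 1
  | add e f => cost e + cost f + 1
  | sub e f => cost e + cost f + 1
  | load _ e => cost e + 1
  | ite c e f => cost c + cost e + cost f + 1
  | sum _ e => Polynomial.X * (cost e + 5) + 6

theorem fits_mono {d d' : ℕ} (h : d ≤ d') (e : Expr) (he : e.fits d = true) :
    e.fits d' = true := by
  induction e with
  | const c => rfl
  | var x => simp only [fits, decide_eq_true_eq] at *; omega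
  | add e f ihe ihf => simp only [fits, Bool.and_eq_true] at *; exact ⟨ihe he.1, ihf he.2⟩
  | sub e f ihe ihf => simp only [fits, Bool.and_eq_true] at *; exact ⟨ihe he.1, ihf he.2⟩
  | load a e ih => exact ih he
  | ite c e f ihc ihe ihf =>
    simp only [fits, Bool.and_eq_true] at *
    exact ⟨⟨ihc he.1.1, ihe he.1.2⟩, ihf he.2⟩
  | sum x e ih =>
    simp only [fits, Bool.and_eq_true, decide_eq_true_eq] at *
    exact ⟨⟨he.1.1, by omega⟩, ih he.2⟩

end Expr

/-! ### Correctness and cost of compiled expressions -/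

/-- Two states have the same arrays and agree on the registers below `d`. -/
def Agree (d : ℕ) (σ τ : State) : Prop :=
  (∀ r < d, τ.reg r = σ.reg r) ∧ τ.arr = σ.arr

theorem Agree.refl (d : ℕ) (σ : State) : Agree d σ σ := ⟨fun _ _ => rfl, rfl⟩

theorem Agree.trans {d : ℕ} {σ τ υ : State} (h : Agree d σ τ) (h' : Agree d τ υ) :
    Agree d σ υ :=
  ⟨fun r hr => (h'.1 r hr).trans (h.1 r hr), h'.2.trans h.2⟩

theorem Agree.mono {d d' : ℕ} {σ τ : State} (h : Agree d' σ τ) (hd : d ≤ d') : Agree d σ τ :=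
  ⟨fun r hr => h.1 r (hr.trans_le hd), h.2⟩

theorem Agree.setReg {d : ℕ} {σ τ : State} (h : Agree d σ τ) (x v : ℕ) :
    Agree d (σ.setReg x v) (τ.setReg x v) := by
  refine ⟨fun r hr => ?_, h.2⟩
  simp only [State.setReg, Function.update_apply]
  split_ifs
  · rfl
  · exact h.1 r hr

theorem agree_setReg {d r : ℕ} (hr : d ≤ r) (σ : State) (v : ℕ) : Agree d σ (σ.setReg r v) := by
  refine ⟨fun s hs => ?_, rfl⟩
  have : s ≠ r := by omega
  simp [State.setReg, this]

@[simp] theorem State.setReg_reg (σ : State) (r v s : ℕ) :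
    (σ.setReg r v).reg s = if s = r then v else σ.reg s := by
  simp [State.setReg, Function.update_apply]

@[simp] theorem State.setReg_arr (σ : State) (r v : ℕ) : (σ.setReg r v).arr = σ.arr := rfl

@[simp] theorem State.setCell_reg (σ : State) (a i v : ℕ) : (σ.setCell a i v).reg = σ.reg := rfl

@[simp] theorem State.setCell_arr (σ : State) (a i v b j : ℕ) :
    (σ.setCell a i v).arr b j = if b = a ∧ j = i then v else σ.arr b j := by
  by_cases h : b = a
  · subst h
    simp [State.setCell, Function.update_apply]
  · simp [State.setCell, h]

/-- Compiled code leaves arbitrary contents in the registers from `d` on; values of expressions that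
fit below `d` do not see them. -/
theorem Expr.eval_congr {d : ℕ} (hd : 0 < d) (e : Expr) (he : e.fits d = true) {σ τ : State}
    (h : Agree d σ τ) : e.eval τ = e.eval σ := by
  induction e generalizing σ τ with
  | const c => rfl
  | var x => exact h.1 x (by simpa [fits] using he)
  | add e f ihe ihf =>
    simp only [fits, Bool.and_eq_true] at he
    simp only [eval, ihe he.1 h, ihf he.2 h]
  | sub e f ihe ihf =>
    simp only [fits, Bool.and_eq_true] at he
    simp only [eval, ihe he.1 h, ihf he.2 h]
  | load a e ih => simp only [eval, ih he h, h.2]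
  | ite c e f ihc ihe ihf =>
    simp only [fits, Bool.and_eq_true] at he
    simp only [eval, ihc he.1.1 h, ihe he.1.2 h, ihf he.2 h]
  | sum x e ih =>
    simp only [fits, Bool.and_eq_true] at he
    simp only [eval, h.1 0 hd]
    exact Finset.sum_congr rfl fun i _ => ih he.2 (h.setReg x i)

/-- The compiled expression runs within its cost and leaves its value in register `d`. -/
theorem Expr.compile_runs (e : Expr) {d : ℕ} (hd : 0 < d) (he : e.fits d = true) (σ : State) :
    ∃ t τ, Runs (e.compile d) σ t τ ∧ t ≤ e.cost.eval (σ.reg 0) ∧ τ.reg d = e.eval σ ∧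
      Agree d σ τ := by
  induction e generalizing d σ with
  | const c =>
    exact ⟨1, _, Runs.instr _ _, by simp [cost], by simp [Instr.apply, eval],
      agree_setReg le_rfl _ _⟩
  | var x =>
    exact ⟨1, _, Runs.instr _ _, by simp [cost], by simp [Instr.apply, eval],
      agree_setReg le_rfl _ _⟩
  | add e f ihe ihf =>
    simp only [fits, Bool.and_eq_true] at he
    obtain ⟨t₁, τ₁, h₁, ht₁, hv₁, ha₁⟩ := ihe hd he.1 σ
    obtain ⟨t₂, τ₂, h₂, ht₂, hv₂, ha₂⟩ :=
      ihf (Nat.succ_pos d) (fits_mono (Nat.le_succ d) f he.2) τ₁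
    refine ⟨_, _, .seq h₁ (.seq h₂ (.instr _ _)), ?_, ?_, ?_⟩
    · rw [ha₁.1 0 hd] at ht₂
      simp only [cost, Polynomial.eval_add, Polynomial.eval_one]
      omega
    · simp only [Instr.apply, State.setReg_reg, if_true, eval]
      rw [hv₂, ha₂.1 d (Nat.lt_succ_self d), hv₁, eval_congr hd f he.2 ha₁]
    · exact (ha₁.trans (ha₂.mono (Nat.le_succ d))).trans (agree_setReg le_rfl _ _)
  | sub e f ihe ihf =>
    simp only [fits, Bool.and_eq_true] at he
    obtain ⟨t₁, τ₁, h₁, ht₁, hv₁, ha₁⟩ := ihe hd he.1 σ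
    obtain ⟨t₂, τ₂, h₂, ht₂, hv₂, ha₂⟩ :=
      ihf (Nat.succ_pos d) (fits_mono (Nat.le_succ d) f he.2) τ₁
    refine ⟨_, _, .seq h₁ (.seq h₂ (.instr _ _)), ?_, ?_, ?_⟩
    · rw [ha₁.1 0 hd] at ht₂
      simp only [cost, Polynomial.eval_add, Polynomial.eval_one]
      omega
    · simp only [Instr.apply, State.setReg_reg, if_true, eval]
      rw [hv₂, ha₂.1 d (Nat.lt_succ_self d), hv₁, eval_congr hd f he.2 ha₁]
    · exact (ha₁.trans (ha₂.mono (Nat.le_succ d))).trans (agree_setReg le_rfl _ _)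
  | load a e ih =>
    obtain ⟨t₁, τ₁, h₁, ht₁, hv₁, ha₁⟩ := ih hd he σ
    refine ⟨_, _, .seq h₁ (.instr _ _), ?_, ?_, ha₁.trans (agree_setReg le_rfl _ _)⟩
    · simp only [cost, Polynomial.eval_add, Polynomial.eval_one]
      omega
    · simp only [Instr.apply, State.setReg_reg, if_true, eval]
      rw [hv₁, ha₁.2]
  | ite c e f ihc ihe ihf =>
    simp only [fits, Bool.and_eq_true] at he
    obtain ⟨t₁, τ₁, h₁, ht₁, hv₁, ha₁⟩ := ihc hd he.1.1 σ
    by_cases hc : c.eval σ = 0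
    · obtain ⟨t₂, τ₂, h₂, ht₂, hv₂, ha₂⟩ := ihf hd he.2 τ₁
      refine ⟨_, _, .seq h₁ (.iteFalse (by rw [hv₁, hc]) h₂), ?_, ?_, ha₁.trans ha₂⟩
      · rw [ha₁.1 0 hd] at ht₂
        simp only [cost, Polynomial.eval_add, Polynomial.eval_one]
        omega
      · rw [hv₂, eval_congr hd f he.2 ha₁]
        simp [eval, hc]
    · obtain ⟨t₂, τ₂, h₂, ht₂, hv₂, ha₂⟩ := ihe hd he.1.2 τ₁
      refine ⟨_, _, .seq h₁ (.iteTrue (by rwa [hv₁]) h₂), ?_, ?_, ha₁.trans ha₂⟩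
      · rw [ha₁.1 0 hd] at ht₂
        simp only [cost, Polynomial.eval_add, Polynomial.eval_one]
        omega
      · rw [hv₂, eval_congr hd e he.1.2 ha₁]
        simp [eval, hc]
  | sum x e ih =>
    simp only [fits, Bool.and_eq_true, decide_eq_true_eq] at he
    obtain ⟨⟨hx0, hxd⟩, he⟩ := he
    -- Register d accumulates the sum, d + 1 keeps the old content of x, d + 2 counts down the
    -- remaining rounds, and d + 3 holds the summand and then the constant 1. A round costs the
    -- body, four instructions and a test.
    have loop : ∀ (m i acc : ℕ) (υ : State), υ.reg (d + 2) = m → υ.reg d = acc →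
        Agree d (σ.setReg x i) υ →
        ∃ t τ, Runs (.while (d + 2) <|
          .seq (compile e (d + 3)) <| .seq (.instr (.add d d (d + 3))) <|
          .seq (.instr (.const (d + 3) 1)) <| .seq (.instr (.add x x (d + 3)))
            (.instr (.sub (d + 2) (d + 2) (d + 3)))) υ t τ ∧
          t ≤ m * (e.cost.eval (σ.reg 0) + 5) + 1 ∧
          τ.reg d = acc + ∑ j ∈ Finset.range m, e.eval (σ.setReg x (i + j)) ∧
          τ.reg (d + 1) = υ.reg (d + 1) ∧ Agree d (σ.setReg x (i + m)) τ := by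
      intro m
      induction m with
      | zero =>
        intro i acc υ hm hacc hυ
        exact ⟨1, υ, .whileFalse hm, by simp, by simpa using hacc, rfl, by simpa using hυ⟩
      | succ m ihm =>
        intro i acc υ hm hacc hυ
        obtain ⟨t₁, τ₁, h₁, ht₁, hv₁, ha₁⟩ :=
          ih (Nat.succ_pos (d + 2)) (fits_mono (by omega) e he) υ
        have hυ0 : υ.reg 0 = σ.reg 0 := by
          rw [hυ.1 0 hd]
          simp [Ne.symm hx0]
        have hev : e.eval υ = e.eval (σ.setReg x i) := eval_congr hd e he hυ
        have hreg : ∀ r < d + 3, τ₁.reg r = υ.reg r := ha₁.1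
        set τ₂ := (Instr.sub (d + 2) (d + 2) (d + 3)).apply ((Instr.add x x (d + 3)).apply
          ((Instr.const (d + 3) 1).apply ((Instr.add d d (d + 3)).apply τ₁))) with hτ₂
        have hxd' : x ≠ d ∧ x ≠ d + 1 ∧ x ≠ d + 2 ∧ x ≠ d + 3 := by omega
        have e1 : τ₂.reg (d + 2) = m := by
          simp [hτ₂, Instr.apply, hreg, hm, hxd'.2.2.1.symm, hxd'.2.2.2.symm]
        have e2 : τ₂.reg d = acc + e.eval (σ.setReg x i) := by
          simp [hτ₂, Instr.apply, hreg, hacc, hv₁, hev, hxd'.1.symm]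
        have e3 : Agree d (σ.setReg x (i + 1)) τ₂ := by
          refine ⟨fun r hr => ?_, ?_⟩
          · have hr' : r ≠ d ∧ r ≠ d + 2 ∧ r ≠ d + 3 := by omega
            by_cases hrx : r = x
            · subst hrx
              have : υ.reg r = i := by
                rw [hυ.1 r hr]
                simp
              simp [hτ₂, Instr.apply, hreg r (by omega), this, hr']
            · have : υ.reg r = σ.reg r := by
                rw [hυ.1 r hr]
                simp [hrx]
              simp [hτ₂, Instr.apply, hreg r (by omega), this, hr', hrx]
          · simpa [hτ₂, Instr.apply, ha₁.2] using hυ.2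
        have e4 : τ₂.reg (d + 1) = υ.reg (d + 1) := by
          simp [hτ₂, Instr.apply, hreg, hxd'.2.1.symm]
        obtain ⟨t, τ, hrun, ht, hvd, hvs, hag⟩ := ihm (i + 1) _ τ₂ e1 e2 e3
        refine ⟨_, τ, .whileTrue (by rw [hm]; exact Nat.succ_ne_zero m)
          (.seq h₁ (.seq (.instr _ _) (.seq (.instr _ _) (.seq (.instr _ _) (.instr _ _))))) hrun,
          ?_, ?_, hvs.trans e4, ?_⟩
        · rw [hυ0] at ht₁
          rw [Nat.succ_mul]
          omega
        · rw [hvd, Finset.sum_range_succ', add_assoc]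
          congr 1
          rw [add_comm, add_zero]
          congr 1
          exact Finset.sum_congr rfl fun j _ => by rw [add_assoc, add_comm 1 j]
        · rwa [add_assoc, add_comm 1 m] at hag
    set σ₁ := (Instr.copy (d + 2) 0).apply ((Instr.const x 0).apply ((Instr.const d 0).apply
      ((Instr.copy (d + 1) x).apply σ))) with hσ₁
    have hxd' : x ≠ d ∧ x ≠ d + 1 ∧ x ≠ d + 2 := by omega
    have f1 : σ₁.reg (d + 2) = σ.reg 0 := by
      simp [hσ₁, Instr.apply, Ne.symm hx0, hd.ne]
    have f2 : σ₁.reg d = 0 := by simp [hσ₁, Instr.apply, hxd'.1.symm]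
    have f3 : Agree d (σ.setReg x 0) σ₁ := by
      refine ⟨fun r hr => ?_, rfl⟩
      have hr' : r ≠ d ∧ r ≠ d + 1 ∧ r ≠ d + 2 := by omega
      simp [hσ₁, Instr.apply, hr']
    have f4 : σ₁.reg (d + 1) = σ.reg x := by
      simp [hσ₁, Instr.apply, hxd'.2.1.symm]
    obtain ⟨t, τ, hrun, ht, hvd, hvs, hag⟩ := loop _ 0 0 σ₁ f1 f2 f3
    refine ⟨_, _, .seq (.instr _ _) (.seq (.instr _ _) (.seq (.instr _ _) (.seq (.instr _ _)
      (.seq hrun (.instr _ _))))), ?_, ?_, ?_, ?_⟩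
    · simp only [cost, Polynomial.eval_add, Polynomial.eval_mul, Polynomial.eval_X,
        Polynomial.eval_ofNat]
      omega
    · simp only [Instr.apply, State.setReg_reg, hxd'.1.symm, if_false, eval]
      simpa using hvd
    · intro r hr
      by_cases hrx : r = x
      · simp [Instr.apply, hrx, hvs, f4]
      · have := hag.1 r hr
        simp only [State.setReg_reg, hrx, if_false] at this
        simp [Instr.apply, hrx, this]
    · exact hag.2

/-! ### Blocks of assignments and loops -/

/-- `reg r := e`, with scratch registers from `d` on. -/
def assign (d r : ℕ) (e : Expr) : Program := .seq (e.compile d) (.instr (.copy r d))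

theorem assign_runs {d r : ℕ} (hd : 0 < d) {e : Expr} (he : e.fits d = true) (σ : State) :
    ∃ t τ, Runs (assign d r e) σ t τ ∧ t ≤ e.cost.eval (σ.reg 0) + 1 ∧
      Agree d (σ.setReg r (e.eval σ)) τ := by
  obtain ⟨t, τ, h, ht, hv, ha⟩ := e.compile_runs hd he σ
  refine ⟨_, _, .seq h (.instr _ _), by omega, ?_⟩
  simp only [Instr.apply, hv]
  exact ha.setReg r _

/-- The effect of a list of assignments, performed one after another. -/
def blockState (L : List (ℕ × Expr)) (σ : State) : State :=
  L.foldl (fun υ p => υ.setReg p.1 (p.2.eval υ)) σ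

/-- A list of assignments followed by `P`. -/
def block (d : ℕ) (P : Program) : List (ℕ × Expr) → Program
  | [] => P
  | p :: L => .seq (assign d p.1 p.2) (block d P L)

/-- A bound on the running time of a list of assignments. -/
noncomputable def blockCost : List (ℕ × Expr) → Polynomial ℕ
  | [] => 0
  | p :: L => p.2.cost + 1 + blockCost L

theorem Agree.blockState {d : ℕ} (hd : 0 < d) {L : List (ℕ × Expr)}
    (hL : ∀ p ∈ L, p.2.fits d = true) {σ τ : State} (h : Agree d σ τ) :
    Agree d (blockState L σ) (blockState L τ) := by
  induction L generalizing σ τ with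
  | nil => exact h
  | cons p L ih =>
    refine ih (fun q hq => hL q (List.mem_cons_of_mem _ hq)) ?_
    dsimp only
    rw [Expr.eval_congr hd p.2 (hL p List.mem_cons_self) h]
    exact h.setReg _ _

/-- The continuation `P` has to be treated from every state that agrees below `d` with the ideal
result, since the scratch registers are not tracked. No assignment may touch register 0, which
bounds all sums and costs. -/
theorem block_runs {d : ℕ} (hd : 0 < d) {P : Program} {L : List (ℕ × Expr)}
    (hL : ∀ p ∈ L, p.2.fits d = true ∧ p.1 ≠ 0) {T : ℕ} {Q : State → Prop} (σ : State)
    (hP : ∀ τ, Agree d (blockState L σ) τ → ∃ t υ, Runs P τ t υ ∧ t ≤ T ∧ Q υ) :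
    ∃ t τ, Runs (block d P L) σ t τ ∧ t ≤ (blockCost L).eval (σ.reg 0) + T ∧ Q τ := by
  induction L generalizing σ with
  | nil => simpa [block, blockCost] using hP σ (Agree.refl _ _)
  | cons p L ih =>
    have hp := hL p List.mem_cons_self
    have hL' := fun q hq => hL q (List.mem_cons_of_mem p hq)
    obtain ⟨t₁, τ₁, h₁, ht₁, ha₁⟩ := assign_runs (r := p.1) hd hp.1 σ
    obtain ⟨t₂, τ₂, h₂, ht₂, hQ⟩ := ih hL' τ₁ fun τ hτ =>
      hP τ ((ha₁.blockState hd fun q hq => (hL' q hq).1).trans hτ)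
    refine ⟨_, τ₂, .seq h₁ h₂, ?_, hQ⟩
    have h0 : τ₁.reg 0 = σ.reg 0 := by
      rw [ha₁.1 0 hd]
      simp [hp.2.symm]
    rw [h0] at ht₂
    simp only [blockCost, Polynomial.eval_add, Polynomial.eval_one]
    omega

/-- Total correctness of a `while` loop with an invariant that carries a decreasing measure. -/
theorem while_runs {r T : ℕ} {P : Program} (Inv : ℕ → State → Prop)
    (hP : ∀ m σ, Inv m σ → σ.reg r ≠ 0 → ∃ t τ, Runs P σ t τ ∧ t ≤ T ∧ ∃ m' < m, Inv m' τ)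
    (m : ℕ) (σ : State) (hσ : Inv m σ) :
    ∃ t τ, Runs (.while r P) σ t τ ∧ t ≤ m * (T + 1) + 1 ∧ (∃ m', Inv m' τ) ∧ τ.reg r = 0 := by
  induction m using Nat.strong_induction_on generalizing σ with
  | _ m ih =>
    by_cases h0 : σ.reg r = 0
    · exact ⟨1, σ, .whileFalse h0, by omega, ⟨m, hσ⟩, h0⟩
    · obtain ⟨t₁, τ₁, h₁, ht₁, m', hm', hi₁⟩ := hP m σ hσ h0
      obtain ⟨t₂, τ₂, h₂, ht₂, hi₂, hr₂⟩ := ih m' hm' τ₁ hi₁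
      refine ⟨_, τ₂, .whileTrue h0 h₁ h₂, ?_, hi₂, hr₂⟩
      have := Nat.mul_le_mul_right (T + 1) (Nat.succ_le_of_lt hm')
      rw [Nat.succ_mul] at this
      omega

/-! #### Derived expressions -/

namespace Expr

/-- The expression has a nonzero value. -/
def Holds (e : Expr) (σ : State) : Prop := e.eval σ ≠ 0

def not (e : Expr) : Expr := ite e (const 0) (const 1)
def and (e f : Expr) : Expr := ite e f (const 0)
def or (e f : Expr) : Expr := ite e (const 1) f
def imp (e f : Expr) : Expr := ite e f (const 1)
def le (e f : Expr) : Expr := sub (add f (const 1)) e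
def lt (e f : Expr) : Expr := sub f e
def all (x : ℕ) (e : Expr) : Expr := not (sum x (not e))
def count (x : ℕ) (e : Expr) : Expr := sum x (ite e (const 1) (const 0))

/-- The product of `e`, which is at most the content of register `0`, and `f`; `x` is fresh. -/
def mul (x : ℕ) (e f : Expr) : Expr := sum x (ite (lt (var x) e) f (const 0))

/-- The least value of `x` for which `e` holds; `y` is fresh. -/
def find (x y : ℕ) (e : Expr) : Expr :=
  sum y (ite (sum x (and (le (var x) (var y)) e)) (const 0) (const 1))

variable {e f : Expr} {σ : State} {n : ℕ}

theorem holds_not : e.not.Holds σ ↔ ¬ e.Holds σ := by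
  simp [Holds, not, eval]

theorem holds_and : (e.and f).Holds σ ↔ e.Holds σ ∧ f.Holds σ := by
  by_cases h : e.eval σ = 0 <;> simp [Holds, and, eval, h]

theorem holds_or : (e.or f).Holds σ ↔ e.Holds σ ∨ f.Holds σ := by
  by_cases h : e.eval σ = 0 <;> simp [Holds, or, eval, h]

theorem holds_imp : (e.imp f).Holds σ ↔ (e.Holds σ → f.Holds σ) := by
  by_cases h : e.eval σ = 0 <;> simp [Holds, imp, eval, h]

theorem holds_le : (e.le f).Holds σ ↔ e.eval σ ≤ f.eval σ := by
  simp only [Holds, le, eval]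
  omega

theorem holds_lt : (e.lt f).Holds σ ↔ e.eval σ < f.eval σ := by
  simp only [Holds, lt, eval]
  omega

theorem eval_sum (h : σ.reg 0 = n) (x : ℕ) :
    (sum x e).eval σ = ∑ i : Fin n, e.eval (σ.setReg x i) := by
  rw [eval, h, Finset.sum_range]

theorem holds_sum (h : σ.reg 0 = n) (x : ℕ) :
    (sum x e).Holds σ ↔ ∃ i : Fin n, e.Holds (σ.setReg x i) := by
  simp [Holds, eval_sum h]

theorem holds_all (h : σ.reg 0 = n) (x : ℕ) :
    (all x e).Holds σ ↔ ∀ i : Fin n, e.Holds (σ.setReg x i) := by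
  simp [all, holds_not, holds_sum h]

theorem eval_ite (c : Expr) [Decidable (c.Holds σ)] :
    (ite c e f).eval σ = if c.Holds σ then e.eval σ else f.eval σ := by
  simp only [Holds, eval]
  congr

theorem eval_count (h : σ.reg 0 = n) (x : ℕ) {P : Fin n → Prop} [DecidablePred P]
    (hP : ∀ i : Fin n, e.Holds (σ.setReg x i) ↔ P i) :
    (count x e).eval σ = (Finset.univ.filter P).card := by
  classical
  rw [count, eval_sum h, Finset.card_filter]
  refine Finset.sum_congr rfl fun i _ => ?_
  rw [eval_ite]
  simp only [hP, eval]

/-- The product sums copies of `f` over the indices below the value of `e`, so only the first factor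
has to be at most n. -/
theorem eval_mul (h : σ.reg 0 = n) {x a b : ℕ} (ha : ∀ i : Fin n, e.eval (σ.setReg x i) = a)
    (hb : ∀ i : Fin n, f.eval (σ.setReg x i) = b) (han : a ≤ n) :
    (mul x e f).eval σ = a * b := by
  classical
  rw [mul, eval_sum h]
  have : ∀ i : Fin n, (ite (lt (var x) e) f (const 0)).eval (σ.setReg x i) =
      if (i : ℕ) < a then b else 0 := by
    intro i
    rw [eval_ite]
    simp only [holds_lt, ha, hb, eval, State.setReg_reg, if_true]
  rw [Finset.sum_congr rfl fun i _ => this i,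
    ← Finset.sum_range (n := n) (fun i => if i < a then b else 0), ← Finset.sum_filter,
    Finset.sum_const, smul_eq_mul]
  congr 1
  have : (Finset.range n).filter (fun i => i < a) = Finset.range a := by
    ext i
    simp only [Finset.mem_filter, Finset.mem_range]
    omega
  rw [this, Finset.card_range]

/-- The number of y for which no x ≤ y is a witness equals the least witness. The test runs inside
the loop over `y`, so it must be correct for every content j of that register. Minimality is not
needed later and is dropped. -/
theorem eval_find (h : σ.reg 0 = n) {x y : ℕ} (hxy : x ≠ y) (hy : y ≠ 0) {P : Fin n → Prop}
    (hP : ∀ j i : Fin n, e.Holds ((σ.setReg y j).setReg x i) ↔ P i) (hex : ∃ i, P i) :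
    ∃ i, P i ∧ (find x y e).eval σ = i := by
  classical
  have hex' : ∃ k, ∃ hk : k < n, P ⟨k, hk⟩ := by
    obtain ⟨i, hi⟩ := hex
    exact ⟨i, i.2, hi⟩
  obtain ⟨hk, hPk⟩ := Nat.find_spec hex'
  refine ⟨⟨Nat.find hex', hk⟩, hPk, ?_⟩
  have h1 : ∀ j : Fin n,
      (ite (sum x (and (le (var x) (var y)) e)) (const 0) (const 1)).eval (σ.setReg y j) =
      if (j : ℕ) < Nat.find hex' then 1 else 0 := by
    intro j
    have h2 : (sum x (and (le (var x) (var y)) e)).Holds (σ.setReg y j) ↔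
        ¬ (j : ℕ) < Nat.find hex' := by
      rw [holds_sum (n := n) (by simp [hy.symm, h])]
      simp only [holds_and, holds_le, hP, eval, State.setReg_reg, if_true, hxy.symm, if_false]
      constructor
      · rintro ⟨i, hij, hi⟩ hlt
        exact Nat.find_min hex' (hij.trans_lt hlt) ⟨i.2, hi⟩
      · intro hle
        exact ⟨⟨_, hk⟩, not_lt.1 hle, hPk⟩
    rw [eval_ite]
    by_cases hj : (j : ℕ) < Nat.find hex' <;> simp [h2, hj, eval]
  rw [find, eval_sum h, Finset.sum_congr rfl fun j _ => h1 j,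
    ← Finset.sum_range (n := n) (fun j => if j < Nat.find hex' then 1 else 0),
    ← Finset.sum_filter, Finset.sum_const, smul_eq_mul, mul_one]
  have : (Finset.range n).filter (fun i => i < Nat.find hex') = Finset.range (Nat.find hex') := by
    ext i
    simp only [Finset.mem_filter, Finset.mem_range]
    omega
  rw [this, Finset.card_range]

end Expr

end RAM

/-! ### The extremal ratio of a splitgraph by balancing tokens -/

namespace SimpleGraph

open Classical Finset

variable {V : Type*}

/-- The neighbours of `v` form a clique. -/
def IsSimplicial (G : SimpleGraph V) (v : V) : Prop :=
  ∀ u w, G.Adj v u → G.Adj v w → u ≠ w → G.Adj u w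

/-- The non-neighbours of `v`, including `v`, form an independent set. -/
def IsCosimplicial (G : SimpleGraph V) (v : V) : Prop :=
  ∀ u w, ¬ G.Adj v u → ¬ G.Adj v w → ¬ G.Adj u w

/-- Neighbours of a vertex of `S` lie in the clique; non-neighbours of a vertex v of `C` are v
itself and members of `S`. Unlike the partition, both properties can be read off the adjacency
matrix. -/
theorem IsSplitgraph.simplicial_or_cosimplicial {G : SimpleGraph V} (h : G.IsSplitgraph) (v : V) :
    G.IsSimplicial v ∨ G.IsCosimplicial v := by
  obtain ⟨S, C, hSC, hS, hC⟩ := h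
  have hmem : ∀ u, u ∈ S ∨ u ∈ C := fun u => by
    have : u ∈ S ⊔ C := by
      rw [hSC.sup_eq_top]
      trivial
    exact this
  have hS' : ∀ u ∈ S, ∀ w ∈ S, ¬ G.Adj u w := fun u hu w hw h => hS hu hw h.ne h
  rcases hmem v with hv | hv
  · refine Or.inl fun u w hu hw huw => hC ?_ ?_ huw
    · exact (hmem u).resolve_left fun h => hS' v hv u h hu
    · exact (hmem w).resolve_left fun h => hS' v hv w h hw
  · have key : ∀ u, ¬ G.Adj v u → u = v ∨ u ∈ S := by
      intro u hu
      by_cases huv : u = v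
      · exact Or.inl huv
      · exact Or.inr ((hmem u).resolve_right fun h => hu (hC hv h (Ne.symm huv)))
    refine Or.inr fun u w hu hw huw => ?_
    rcases key u hu with rfl | hu'
    · exact hw huw
    rcases key w hw with rfl | hw'
    · exact hu huw.symm
    exact hS' u hu' w hw' huw

theorem IsSimplicial.closed_iff {G : SimpleGraph V} {u v : V} (hu : G.IsSimplicial u)
    (hv : G.IsSimplicial v) (huv : u = v ∨ G.Adj u v) (x : V) :
    (u = x ∨ G.Adj u x) ↔ (v = x ∨ G.Adj v x) := by
  have key : ∀ {u v : V}, G.IsSimplicial u → G.Adj u v → (u = x ∨ G.Adj u x) →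
      (v = x ∨ G.Adj v x) := by
    intro u v hu h
    rintro (rfl | hx)
    · exact Or.inr h.symm
    · by_cases hvx : v = x
      · exact Or.inl hvx
      · exact Or.inr (hu v x h hx hvx)
  rcases huv with rfl | h
  · rfl
  · exact ⟨key hu h, key hv h.symm⟩

section Rep

set_option linter.unusedSectionVars false

variable [Fintype V] [LinearOrder V] {G : SimpleGraph V}

/-- The least vertex of a class of adjacent simplicial vertices. -/
def IsRep (G : SimpleGraph V) (v : V) : Prop :=
  G.IsSimplicial v ∧ ∀ u, u < v → G.Adj u v → ¬ G.IsSimplicial u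

theorem IsRep.not_adj {u v : V} (hu : G.IsRep u) (hv : G.IsRep v) : ¬ G.Adj u v := by
  intro h
  rcases lt_or_gt_of_ne h.ne with hlt | hlt
  · exact hv.2 u hlt h hu.1
  · exact hu.2 v hlt h.symm hv.1

theorem IsSimplicial.exists_isRep {v : V} (hv : G.IsSimplicial v) :
    ∃ u, G.IsRep u ∧ (v = u ∨ G.Adj v u) := by
  set K : Finset V := univ.filter fun u => G.IsSimplicial u ∧ (v = u ∨ G.Adj v u) with hK
  have hne : K.Nonempty := ⟨v, by simp [hK, hv]⟩
  have hmin := K.min'_mem hne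
  obtain ⟨hs, hvu⟩ := (mem_filter.1 hmin).2
  refine ⟨K.min' hne, ⟨hs, fun w hw hadj hws => ?_⟩, hvu⟩
  refine absurd (K.min'_le w (mem_filter.2 ⟨mem_univ _, hws, ?_⟩)) (not_le.2 hw)
  exact (hv.closed_iff hs hvu w).2 (Or.inr hadj.symm)

/-- Adjacent simplicial vertices have equal closed neighbourhoods, so each vertex can be exchanged
for its representative. Two vertices of `J` with the same representative would be equal or adjacent.
-/
theorem exists_isRep_finset {J : Finset V} (hJ : G.IsIndepSet J)
    (hs : ∀ v ∈ J, G.IsSimplicial v) :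
    ∃ J' : Finset V, (∀ v ∈ J', G.IsRep v) ∧ #J' = #J ∧ G.closedNbhd J' = G.closedNbhd J := by
  choose! f hf hvf using fun v (hv : v ∈ J) => (hs v hv).exists_isRep
  have hcl : ∀ v ∈ J, ∀ x, (v = x ∨ G.Adj v x) ↔ (f v = x ∨ G.Adj (f v) x) :=
    fun v hv => (hs v hv).closed_iff (hf v hv).1 (hvf v hv)
  refine ⟨J.image f, ?_, card_image_of_injOn fun v hv w hw hvw => ?_, ?_⟩
  · intro u hu
    obtain ⟨v, hv, rfl⟩ := mem_image.1 hu
    exact hf v hv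
  · by_contra hne
    have h1 := (hcl v hv w).2 (by
      simp only [hvw]
      exact (hcl w hw w).1 (Or.inl rfl))
    exact hJ hv hw hne (h1.resolve_left hne)
  · ext y
    simp only [mem_closedNbhd, mem_image, exists_exists_and_eq_and]
    exact exists_congr fun v => and_congr_right fun hv => (hcl v hv y).symm

/-- If `J` contains a cosimplicial v with e non-neighbours and d neighbours, then |J| ≤ e and |N(J)|
≥ d, so |J| / |N[J]| ≤ e / (e + d) = e / |V|. Otherwise `J` is replaced by representatives. -/
theorem IsIndepSet.card_mul_le {a b : ℕ} (hG : ∀ v, G.IsSimplicial v ∨ G.IsCosimplicial v)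
    (h₁ : ∀ J : Finset V, (∀ v ∈ J, G.IsRep v) → #J * b ≤ a * #(G.closedNbhd J))
    (h₂ : ∀ v, G.IsCosimplicial v →
      #(univ.filter fun u => ¬ G.Adj v u) * b ≤ a * Fintype.card V)
    {J : Finset V} (hJ : G.IsIndepSet J) : #J * b ≤ a * #(G.closedNbhd J) := by
  by_cases hs : ∀ v ∈ J, G.IsSimplicial v
  · obtain ⟨J', hJ', hc, hN⟩ := exists_isRep_finset hJ hs
    rw [← hc, ← hN]
    exact h₁ J' hJ'
  · push Not at hs
    obtain ⟨v, hv, hvs⟩ := hs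
    have hc := h₂ v ((hG v).resolve_left hvs)
    rw [card_closedNbhd hJ]
    have hle : #J ≤ #(univ.filter fun u => ¬ G.Adj v u) :=
      card_le_card fun u hu => mem_filter.2 ⟨mem_univ _, hJ.not_adj hv hu⟩
    have hle' : #(univ.filter fun u => G.Adj v u) ≤ #(relNbhd G.Adj J) :=
      card_le_card fun u hu => mem_relNbhd.2 ⟨v, hv, (mem_filter.1 hu).2⟩
    have hn := card_filter_add_card_filter_not (s := (univ : Finset V)) (fun u => G.Adj v u)
    rw [card_univ] at hn
    have hpos : 0 < #(univ.filter fun u => ¬ G.Adj v u) :=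
      card_pos.2 ⟨v, by simp⟩
    rw [← hn] at hc
    generalize #(univ.filter fun u => ¬ G.Adj v u) = e at *
    generalize #(univ.filter fun u => G.Adj v u) = d at *
    generalize #(relNbhd G.Adj J) = m at *
    obtain ⟨w, rfl⟩ := Nat.exists_eq_add_of_le hle
    obtain ⟨w', rfl⟩ := Nat.exists_eq_add_of_le hle'
    refine Nat.le_of_mul_le_mul_left ?_ hpos
    have h3 := Nat.mul_le_mul_left (#J) hc
    have h4 : (#J) * (a * (d + (#J + w))) ≤ (#J + w) * (a * (#J + (d + w'))) := by
      have : (#J + w) * (a * (#J + (d + w'))) =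
        (#J) * (a * (d + (#J + w))) + a * (#J * w' + w * d + w * w') := by ring
      omega
    calc (#J + w) * (#J * b) = #J * ((#J + w) * b) := by ring
      _ ≤ _ := h3.trans h4

theorem hasTensorCapacity_of_ratio {a b : ℕ} (hb : b ≠ 0)
    (hJ : ∀ J : Finset V, G.IsIndepSet J → #J * b ≤ a * #(G.closedNbhd J))
    {I : Finset V} (hI : G.IsIndepSet I) (hne : I.Nonempty)
    (hIab : a * #(G.closedNbhd I) ≤ #I * b) :
    G.HasTensorCapacity (if b < 2 * a then 1 else (a : ℝ) / b) := by
  split_ifs with hab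
  · refine hasTensorCapacity_one hI ?_
    have h1 := hJ I hI
    have h2 := hne.card_pos
    have h3 : #I * b < #I * (2 * a) := Nat.mul_lt_mul_of_pos_left hab h2
    have h4 : a * #(G.closedNbhd I) < a * (2 * #I) := by
      calc _ ≤ #I * b := hIab
        _ < _ := h3
        _ = _ := by ring
    exact lt_of_mul_lt_mul_left h4 (Nat.zero_le a)
  · exact hasTensorCapacity_of_le_half hb (by omega) hJ hI hne hIab

/-! #### Balanced token distributions -/

/-- The number of tokens on a vertex. -/
def tokenLoad (t : V → V → ℕ) (c : V) : ℕ := ∑ s, t s c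

/-- Every representative owns `M` tokens, all of them on its closed neighbourhood. -/
structure IsTokens (G : SimpleGraph V) (M : ℕ) (t : V → V → ℕ) : Prop where
  sum_eq : ∀ s, ∑ c, t s c = if G.IsRep s then M else 0
  closed : ∀ s c, t s c ≠ 0 → s = c ∨ G.Adj s c

/-- A token of `s` on `c` may be moved to `d`, which has a smaller load. -/
def IsMovable (G : SimpleGraph V) (t : V → V → ℕ) (s c d : V) : Prop :=
  t s c ≠ 0 ∧ (s = d ∨ G.Adj s d) ∧ tokenLoad t d + 2 ≤ tokenLoad t c

/-- Move a token of `s` from `c` to `d`. -/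
def moveToken (t : V → V → ℕ) (s c d : V) : V → V → ℕ :=
  fun s' x => if s' = s then (if x = c then t s c - 1 else if x = d then t s d + 1 else t s x)
    else t s' x

/-- With φ the identity this gives conservation of tokens, with φ the square the change of energy.
The additive form keeps truncated subtraction out of the totals. -/
theorem sum_move {f : V → ℕ} {c d : V} (hcd : c ≠ d) (φ : ℕ → ℕ) :
    ∑ x, φ (if x = c then f c - 1 else if x = d then f d + 1 else f x) + φ (f c) + φ (f d) =
      ∑ x, φ (f x) + φ (f c - 1) + φ (f d + 1) := by
  have hd : d ∈ univ.erase c := mem_erase.2 ⟨hcd.symm, mem_univ _⟩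
  rw [← add_sum_erase univ _ (mem_univ c), ← add_sum_erase univ (fun x => φ (f x)) (mem_univ c),
    ← add_sum_erase _ _ hd, ← add_sum_erase _ (fun x => φ (f x)) hd]
  have : ∑ x ∈ (univ.erase c).erase d,
      φ (if x = c then f c - 1 else if x = d then f d + 1 else f x) =
      ∑ x ∈ (univ.erase c).erase d, φ (f x) := by
    refine sum_congr rfl fun x hx => ?_
    simp only [mem_erase] at hx
    simp [hx.1, hx.2.1]
  rw [this]
  simp only [if_true, hcd.symm, if_false]
  omega

theorem IsMovable.ne {t : V → V → ℕ} {s c d : V} (h : IsMovable G t s c d) : c ≠ d := by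
  rintro rfl
  have := h.2.2
  omega

theorem tokenLoad_moveToken {t : V → V → ℕ} {s c d : V} (hcd : c ≠ d) (h : t s c ≠ 0) (x : V) :
    tokenLoad (moveToken t s c d) x =
      if x = c then tokenLoad t c - 1 else if x = d then tokenLoad t d + 1 else tokenLoad t x := by
  have key : ∀ y, tokenLoad t y = t s y + ∑ u ∈ univ.erase s, t u y := fun y =>
    (add_sum_erase univ (fun u => t u y) (mem_univ s)).symm
  have key' : tokenLoad (moveToken t s c d) x =
      moveToken t s c d s x + ∑ u ∈ univ.erase s, t u x := by
    rw [tokenLoad, ← add_sum_erase univ _ (mem_univ s)]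
    congr 1
    refine sum_congr rfl fun u hu => ?_
    simp [moveToken, (mem_erase.1 hu).1]
  rw [key', key c, key d, key x]
  simp only [moveToken, if_true]
  by_cases hxc : x = c
  · subst hxc
    simp only [if_true]
    omega
  · by_cases hxd : x = d
    · subst hxd
      simp only [hxc, if_true, if_false]
      omega
    · simp [hxc, hxd]

theorem IsTokens.move {M : ℕ} {t : V → V → ℕ} (ht : G.IsTokens M t) {s c d : V}
    (h : IsMovable G t s c d) : G.IsTokens M (moveToken t s c d) := by
  refine ⟨fun s' => ?_, fun s' x hx => ?_⟩
  · rw [← ht.sum_eq s']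
    by_cases hs : s' = s
    · subst hs
      have := sum_move (f := t s') h.ne id
      simp only [id] at this
      simp only [moveToken, if_true]
      have := Nat.pos_of_ne_zero h.1
      omega
    · simp [moveToken, hs]
  · by_cases hs : s' = s
    · subst hs
      by_cases hxd : x = d
      · rw [hxd]
        exact h.2.1
      · refine ht.closed s' x fun h0 => hx ?_
        simp only [moveToken, if_true, hxd, if_false, h0]
        split_ifs with hxc
        · subst hxc
          simp [h0]
        · rfl
    · simp only [moveToken, hs, if_false] at hx
      exact ht.closed s' x hx

/-- The potential that decreases with every move. -/
def tokenEnergy (t : V → V → ℕ) : ℕ := ∑ c, tokenLoad t c ^ 2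

/-- Moving a token from load x to load y ≤ x - 2 lowers the sum of squares by 2 (x - y - 1) ≥ 2. -/
theorem IsMovable.energy_lt {t : V → V → ℕ} {s c d : V} (h : IsMovable G t s c d) :
    tokenEnergy (moveToken t s c d) < tokenEnergy t := by
  have h2 := h.2.2
  have h1 := sum_move (f := tokenLoad t) h.ne (fun x => x ^ 2)
  simp only [tokenEnergy, tokenLoad_moveToken h.ne h.1]
  obtain ⟨w, hw⟩ := Nat.exists_eq_add_of_le h2
  have h3 : tokenLoad t c - 1 = tokenLoad t d + 1 + w := by omega
  rw [h3, hw] at h1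
  rw [h3]
  nlinarith

/-- The vertices with load at least that of `c`. -/
noncomputable def heavy (t : V → V → ℕ) (c : V) : Finset V :=
  univ.filter fun x => tokenLoad t c ≤ tokenLoad t x

/-- The representatives with closed neighbourhood in `heavy t c`. -/
noncomputable def heavyReps (G : SimpleGraph V) (t : V → V → ℕ) (c : V) : Finset V :=
  univ.filter fun s => G.IsRep s ∧ ∀ x, s = x ∨ G.Adj s x → tokenLoad t c ≤ tokenLoad t x

theorem card_heavy_pos (t : V → V → ℕ) (c : V) : 0 < #(heavy t c) :=
  card_pos.2 ⟨c, by simp [heavy]⟩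

theorem isIndepSet_heavyReps (t : V → V → ℕ) (c : V) : G.IsIndepSet (G.heavyReps t c) :=
  isIndepSet_of_not_adj fun _ hx _ hy => (mem_filter.1 hx).2.1.not_adj (mem_filter.1 hy).2.1

theorem closedNbhd_heavyReps_subset (t : V → V → ℕ) (c : V) :
    G.closedNbhd (G.heavyReps t c) ⊆ heavy t c := by
  intro y hy
  obtain ⟨x, hx, hxy⟩ := mem_closedNbhd.1 hy
  exact mem_filter.2 ⟨mem_univ _, (mem_filter.1 hx).2.2 y hxy⟩

/-- Below the maximal value of a function there is a value `θ` such that `θ - 1` is not attained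
and all values from `θ` to the maximum are attained. -/
theorem exists_gap [Nonempty V] (f : V → ℕ) :
    ∃ c, (∀ x, f x < f c → f x + 1 < f c) ∧ ∀ x, f x + 1 ≤ f c + Fintype.card V := by
  obtain ⟨m, hm⟩ := Finite.exists_max f
  have hex : ∃ θ, ∀ y, θ ≤ y → y ≤ f m → ∃ c, f c = y :=
    ⟨f m, fun y h h' => ⟨m, le_antisymm h h'⟩⟩
  set θ := Nat.find hex with hθ
  have hθs := Nat.find_spec hex
  rw [← hθ] at hθs
  have hle : θ ≤ f m := Nat.find_min' hex fun y h h' => ⟨m, le_antisymm h h'⟩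
  obtain ⟨c, hc⟩ := hθs θ le_rfl hle
  refine ⟨c, fun x hx => ?_, fun x => ?_⟩
  · by_contra hcon
    have hx1 : f x + 1 = θ := by omega
    refine Nat.find_min hex (m := f x) (by omega) fun y h h' => ?_
    rcases h.eq_or_lt with rfl | h
    · exact ⟨x, rfl⟩
    · exact hθs y (by omega) h'
  -- The run from θ to the maximum consists of attained values, so its length is at most |V|.
  · have h1 : Finset.Icc θ (f m) ⊆ univ.image f := by
      intro y hy
      rw [Finset.mem_Icc] at hy
      obtain ⟨c, hc⟩ := hθs y hy.1 hy.2
      exact mem_image.2 ⟨c, mem_univ _, hc⟩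
    have h2 := (card_le_card h1).trans card_image_le
    rw [Nat.card_Icc, card_univ] at h2
    have := hm x
    omega

/-- Let L be the load at the gap, T the number of heavy vertices and I the number of heavy
representatives. Tokens on heavy vertices belong to heavy representatives, so T L ≤ I M. All loads
are at most L + |V| - 1, so |J| M ≤ |N[J]| (L + |V| - 1). Eliminating L leaves an error smaller than
M, which integrality absorbs. -/
theorem IsTokens.exists_heavyReps_ratio [Nonempty V] {M : ℕ} {t : V → V → ℕ}
    (ht : G.IsTokens M t) (hst : ∀ s c d, ¬ IsMovable G t s c d) (hM : Fintype.card V ^ 3 ≤ M) :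
    ∃ c, ∀ J : Finset V, (∀ v ∈ J, G.IsRep v) →
      #J * #(heavy t c) ≤ #(G.heavyReps t c) * #(G.closedNbhd J) := by
  obtain ⟨c, hgap, hmax⟩ := exists_gap (tokenLoad t)
  refine ⟨c, fun J hJ => ?_⟩
  have h1 : #(heavy t c) * tokenLoad t c ≤ #(G.heavyReps t c) * M := by
    calc #(heavy t c) * tokenLoad t c = ∑ x ∈ heavy t c, tokenLoad t c := by simp
      _ ≤ ∑ x ∈ heavy t c, tokenLoad t x := sum_le_sum fun x hx => (mem_filter.1 hx).2
      _ = ∑ s, ∑ x ∈ heavy t c, t s x := by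
        simp only [tokenLoad]
        rw [sum_comm]
      _ = ∑ s ∈ G.heavyReps t c, ∑ x ∈ heavy t c, t s x := by
        symm
        refine sum_subset (subset_univ _) fun s _ hs => ?_
        refine sum_eq_zero fun x hx => ?_
        by_contra h0
        refine hs (mem_filter.2 ⟨mem_univ _, ?_, fun y hy => ?_⟩)
        · by_contra hrep
          have := ht.sum_eq s
          rw [if_neg hrep, sum_eq_zero_iff] at this
          exact h0 (this x (mem_univ _))
        · by_contra hlt
          -- A vertex y lighter than the gap load has load at least 2 below it, so the token of s on
          -- the heavy vertex x could move to y.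
          refine hst s x y ⟨h0, hy, ?_⟩
          have h3 := hgap y (by omega)
          have h4 := (mem_filter.1 hx).2
          omega
      _ ≤ ∑ s ∈ G.heavyReps t c, M := by
        refine sum_le_sum fun s hs => ?_
        have := ht.sum_eq s
        rw [if_pos (mem_filter.1 hs).2.1] at this
        rw [← this]
        exact sum_le_sum_of_subset (subset_univ _)
      _ = _ := by simp
  have h2 : #J * M ≤ #(G.closedNbhd J) * (tokenLoad t c + Fintype.card V - 1) := by
    calc #J * M = ∑ s ∈ J, ∑ x, t s x := by
          rw [sum_congr rfl fun s hs => (ht.sum_eq s).trans (if_pos (hJ s hs))]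
          simp
      _ = ∑ s ∈ J, ∑ x ∈ G.closedNbhd J, t s x := by
        refine sum_congr rfl fun s hs => ?_
        symm
        refine sum_subset (subset_univ _) fun x _ hx => ?_
        by_contra h0
        exact hx (mem_closedNbhd.2 ⟨s, hs, ht.closed s x h0⟩)
      _ = ∑ x ∈ G.closedNbhd J, ∑ s ∈ J, t s x := sum_comm
      _ ≤ ∑ x ∈ G.closedNbhd J, (tokenLoad t c + Fintype.card V - 1) := by
        refine sum_le_sum fun x _ => ?_
        have h3 := hmax x
        have h4 : ∑ s ∈ J, t s x ≤ tokenLoad t x := sum_le_sum_of_subset (subset_univ _)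
        omega
      _ = _ := by simp
  have hT := card_le_univ (heavy t c)
  have hN := card_le_univ (G.closedNbhd J)
  generalize #(heavy t c) = T at *
  generalize #(G.closedNbhd J) = N at *
  generalize #(G.heavyReps t c) = I at *
  generalize tokenLoad t c = L at *
  obtain ⟨k, hk⟩ : ∃ k, Fintype.card V = k + 1 :=
    ⟨Fintype.card V - 1, by have := Fintype.card_pos (α := V); omega⟩
  rw [hk] at hT hN hM h2
  rw [show L + (k + 1) - 1 = L + k by omega] at h2
  by_contra hcon
  push Not at hcon
  have h5 : T * (#J * M) ≤ N * (I * M) + N * T * k := by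
    calc T * (#J * M) ≤ T * (N * (L + k)) := Nat.mul_le_mul_left _ h2
      _ = N * (T * L) + N * T * k := by ring
      _ ≤ _ := Nat.add_le_add_right (Nat.mul_le_mul_left _ h1) _
  have h6 : (I * N + 1) * M ≤ #J * T * M := Nat.mul_le_mul_right _ hcon
  have h7 : N * T * k ≤ (k + 1) * (k + 1) * k :=
    Nat.mul_le_mul_right _ (Nat.mul_le_mul hN hT)
  -- With |V| = k + 1 the error N T k stays below |V|^3 ≤ M; this is where the number of tokens
  -- comes from.
  have h8 : (k + 1) * (k + 1) * k < (k + 1) ^ 3 := by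
    rw [pow_succ, pow_two]
    exact Nat.mul_lt_mul_of_pos_left (Nat.lt_succ_self k) (by positivity)
  nlinarith

end Rep

end SimpleGraph

/-! ### The program -/

namespace RAM

open RAM.Expr SimpleGraph

section Expressions

variable {n : ℕ} {G : SimpleGraph (Fin n)} {t : Fin n → Fin n → ℕ} {σ : State}

open Classical in
/-- The memory holds `n`, the adjacency matrix of `G` and the token distribution `t`: array `1`
counts the tokens of `s` that arrived on `c`, and array `2` those that left `c`. -/
structure Represents (G : SimpleGraph (Fin n)) (t : Fin n → Fin n → ℕ) (σ : State) : Prop where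
  size : σ.reg 0 = n
  adj : ∀ i j : Fin n, σ.arr 0 (n * i + j) = if G.Adj i j then 1 else 0
  tok : ∀ s c : Fin n, (if s = c ∧ G.IsRep s then n ^ 3 else 0) + σ.arr 1 (n * s + c) =
    t s c + σ.arr 2 (n * s + c)

theorem Represents.setReg (h : Represents G t σ) {x : ℕ} (hx : x ≠ 0) (v : ℕ) :
    Represents G t (σ.setReg x v) :=
  ⟨by simp [hx.symm, h.size], h.adj, h.tok⟩

theorem Agree.represents {d : ℕ} (hd : 0 < d) {τ : State} (ha : Agree d σ τ)
    (h : Represents G t σ) : Represents G t τ :=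
  ⟨by rw [ha.1 0 hd, h.size], by rw [ha.2]; exact h.adj, by rw [ha.2]; exact h.tok⟩

theorem index_inj {s c s' c' : Fin n} (h : n * (s : ℕ) + c = n * s' + c') : s = s' ∧ c = c' := by
  have hn : 0 < n := s.pos
  have h1 := congrArg (· / n) h
  have h2 := congrArg (· % n) h
  simp only [Nat.mul_add_div hn, Nat.div_eq_of_lt c.2, Nat.div_eq_of_lt c'.2,
    Nat.mul_add_mod, Nat.mod_eq_of_lt c.2, Nat.mod_eq_of_lt c'.2, add_zero] at h1 h2
  exact ⟨Fin.ext h1, Fin.ext h2⟩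

/-- The position of the pair `x, y` in an array. -/
def idxE (x y : ℕ) : Expr := add (sum 2 (var x)) (var y)

/-- Multiplication by n is a sum over register 2, so `x` must not be that register. -/
theorem eval_idxE (h : σ.reg 0 = n) {x : ℕ} (hx : 2 < x) (y : ℕ) :
    (idxE x y).eval σ = n * σ.reg x + σ.reg y := by
  have : x ≠ 2 := by omega
  simp [idxE, eval, h, this]

/-- `x` and `y` are adjacent. -/
def adjE (x y : ℕ) : Expr := load 0 (idxE x y)

theorem holds_adjE (h : Represents G t σ) {x y : ℕ} (hx : 2 < x) {u v : Fin n}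
    (hu : σ.reg x = u) (hv : σ.reg y = v) : (adjE x y).Holds σ ↔ G.Adj u v := by
  simp [Holds, adjE, eval, eval_idxE h.size hx, hu, hv, h.adj]

/-- `x` and `y` are equal. -/
def eqE (x y : ℕ) : Expr := and (le (var x) (var y)) (le (var y) (var x))

theorem holds_eqE {x y : ℕ} {u v : Fin n}
    (hu : σ.reg x = u) (hv : σ.reg y = v) : (eqE x y).Holds σ ↔ u = v := by
  simp only [eqE, holds_and, holds_le, eval, hu, hv, Fin.ext_iff]
  omega

/-- `y` is in the closed neighbourhood of `x`. -/
def closedE (x y : ℕ) : Expr := or (eqE x y) (adjE x y)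

theorem holds_closedE (h : Represents G t σ) {x y : ℕ} (hx : 2 < x) {u v : Fin n}
    (hu : σ.reg x = u) (hv : σ.reg y = v) :
    (closedE x y).Holds σ ↔ (u = v ∨ G.Adj u v) := by
  rw [closedE, holds_or, holds_eqE hu hv, holds_adjE h hx hu hv]

/-- `x` is simplicial. -/
def simplicialE (x : ℕ) : Expr :=
  all 3 (all 4 (imp (adjE x 3) (imp (adjE x 4) (imp (not (eqE 3 4)) (adjE 3 4)))))

/-- Each derived expression binds fixed low registers; lower bounds such as 4 < x keep its arguments
from being captured. -/
theorem holds_simplicialE (h : Represents G t σ) {x : ℕ} (hx : 4 < x) {u : Fin n}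
    (hu : σ.reg x = u) : (simplicialE x).Holds σ ↔ G.IsSimplicial u := by
  have hx3 : x ≠ 3 := by omega
  have hx4 : x ≠ 4 := by omega
  rw [simplicialE, holds_all h.size]
  refine forall_congr' fun i => ?_
  rw [holds_all (h.setReg (by decide) _).size]
  refine forall_congr' fun j => ?_
  have h' := (h.setReg (x := 3) (by decide) i).setReg (x := 4) (by decide) j
  have h3 : ((σ.setReg 3 i).setReg 4 j).reg 3 = i := by simp
  have h4 : ((σ.setReg 3 i).setReg 4 j).reg 4 = j := by simp
  have hx' : ((σ.setReg 3 i).setReg 4 j).reg x = u := by simp [hx3, hx4, hu]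
  rw [holds_imp, holds_imp, holds_imp, holds_not, holds_adjE h' (by omega) hx' h3,
    holds_adjE h' (by omega) hx' h4, holds_eqE h3 h4, holds_adjE h' (by omega) h3 h4]

/-- `x` is cosimplicial. -/
def cosimplicialE (x : ℕ) : Expr :=
  all 3 (all 4 (imp (not (adjE x 3)) (imp (not (adjE x 4)) (not (adjE 3 4)))))

theorem holds_cosimplicialE (h : Represents G t σ) {x : ℕ} (hx : 4 < x) {u : Fin n}
    (hu : σ.reg x = u) : (cosimplicialE x).Holds σ ↔ G.IsCosimplicial u := by
  have hx3 : x ≠ 3 := by omega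
  have hx4 : x ≠ 4 := by omega
  rw [cosimplicialE, holds_all h.size]
  refine forall_congr' fun i => ?_
  rw [holds_all (h.setReg (by decide) _).size]
  refine forall_congr' fun j => ?_
  have h' := (h.setReg (x := 3) (by decide) i).setReg (x := 4) (by decide) j
  have h3 : ((σ.setReg 3 i).setReg 4 j).reg 3 = i := by simp
  have h4 : ((σ.setReg 3 i).setReg 4 j).reg 4 = j := by simp
  have hx' : ((σ.setReg 3 i).setReg 4 j).reg x = u := by simp [hx3, hx4, hu]
  rw [holds_imp, holds_imp, holds_not, holds_not, holds_not, holds_adjE h' (by omega) hx' h3,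
    holds_adjE h' (by omega) hx' h4, holds_adjE h' (by omega) h3 h4]

/-- `x` is the least vertex of its class of adjacent simplicial vertices. -/
def repE (x : ℕ) : Expr :=
  and (simplicialE x) (all 5 (imp (lt (var 5) (var x)) (imp (adjE 5 x) (not (simplicialE 5)))))

theorem holds_repE (h : Represents G t σ) {x : ℕ} (hx : 5 < x) {u : Fin n}
    (hu : σ.reg x = u) : (repE x).Holds σ ↔ G.IsRep u := by
  have hx5 : x ≠ 5 := by omega
  rw [repE, holds_and, holds_simplicialE h (by omega) hu, holds_all h.size]
  refine and_congr_right fun _ => forall_congr' fun i => ?_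
  have h' := h.setReg (x := 5) (by decide) i
  have h5 : (σ.setReg 5 i).reg 5 = i := by simp
  have hx' : (σ.setReg 5 i).reg x = u := by simp [hx5, hu]
  rw [holds_imp, holds_imp, holds_lt, holds_not, holds_simplicialE h' (by omega) h5,
    holds_adjE h' (by omega) h5 hx', Expr.eval, Expr.eval, h5, hx', Fin.lt_def]

/-- The number of tokens of `s` on `c`. -/
def tokE (s c : ℕ) : Expr :=
  sub (add (ite (and (eqE s c) (repE s)) (sum 2 (sum 3 (sum 4 (const 1)))) (const 0))
    (load 1 (idxE s c))) (load 2 (idxE s c))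

/-- The initial n^3 tokens are recomputed at each reading, so arrays 1 and 2 may start at zero. The
invariant `tok` makes the truncated subtraction exact. -/
theorem eval_tokE (h : Represents G t σ) {x y : ℕ} (hx : 5 < x) {s c : Fin n}
    (hs : σ.reg x = s) (hc : σ.reg y = c) : (tokE x y).eval σ = t s c := by
  classical
  have h0 := h.tok s c
  have h1 : (and (eqE x y) (repE x)).Holds σ ↔ s = c ∧ G.IsRep s := by
    rw [holds_and, holds_eqE hs hc, holds_repE h hx hs]
  have h2 : (sum 2 (sum 3 (sum 4 (const 1)))).eval σ = n ^ 3 := by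
    simp [eval, h.size]
    ring
  have h3 : (tokE x y).eval σ = (ite (and (eqE x y) (repE x)) (sum 2 (sum 3 (sum 4 (const 1))))
      (const 0)).eval σ + σ.arr 1 ((idxE x y).eval σ) - σ.arr 2 ((idxE x y).eval σ) := rfl
  rw [h3, eval_ite, eval_idxE h.size (by omega), hs, hc, h2]
  simp only [h1]
  simp only [Expr.eval]
  split_ifs at h0 ⊢ <;> omega

/-- The number of tokens on `c`. -/
def loadE (c : ℕ) : Expr := sum 6 (tokE 6 c)

theorem eval_loadE (h : Represents G t σ) {y : ℕ} (hy : 6 < y) {c : Fin n}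
    (hc : σ.reg y = c) : (loadE y).eval σ = tokenLoad t c := by
  have hy6 : y ≠ 6 := by omega
  rw [loadE, eval_sum h.size]
  refine Finset.sum_congr rfl fun i _ => ?_
  exact eval_tokE (h.setReg (by decide) _) (by omega) (by simp) (by simp [hy6, hc])

/-- A token of `s` on `c` may be moved to `d`. -/
def movableE (s c d : ℕ) : Expr :=
  and (tokE s c) (and (closedE s d) (le (add (loadE d) (const 2)) (loadE c)))

theorem holds_movableE (h : Represents G t σ) {x y z : ℕ} (hx : 6 < x) (hy : 6 < y)
    (hz : 6 < z) {s c d : Fin n} (hs : σ.reg x = s) (hc : σ.reg y = c) (hd : σ.reg z = d) :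
    (movableE x y z).Holds σ ↔ IsMovable G t s c d := by
  rw [movableE, holds_and, holds_and, holds_closedE h (by omega) hs hd, holds_le, Expr.eval,
    eval_loadE h hz hd, eval_loadE h hy hc, Holds, eval_tokE h (by omega) hs hc]
  rfl

/-- Some token of `s` on `c` may be moved. -/
def movableFromE (s c : ℕ) : Expr := sum 9 (movableE s c 9)

theorem holds_movableFromE (h : Represents G t σ) {x y : ℕ} (hx : 6 < x) (hy : 6 < y)
    (hx9 : x ≠ 9) (hy9 : y ≠ 9) {s c : Fin n} (hs : σ.reg x = s) (hc : σ.reg y = c) :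
    (movableFromE x y).Holds σ ↔ ∃ d, IsMovable G t s c d := by
  rw [movableFromE, holds_sum h.size]
  refine exists_congr fun d => ?_
  exact holds_movableE (h.setReg (by decide) _) hx hy (by decide) (by simp [hx9, hs])
    (by simp [hy9, hc]) (by simp)

/-- Some token of `s` may be moved. -/
def movableOfE (s : ℕ) : Expr := sum 8 (movableFromE s 8)

theorem holds_movableOfE (h : Represents G t σ) {x : ℕ} (hx : 6 < x)
    (hx8 : x ≠ 8) (hx9 : x ≠ 9) {s : Fin n} (hs : σ.reg x = s) :
    (movableOfE x).Holds σ ↔ ∃ c d, IsMovable G t s c d := by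
  rw [movableOfE, holds_sum h.size]
  refine exists_congr fun d => ?_
  exact holds_movableFromE (h.setReg (by decide) _) hx (by decide) hx9 (by decide)
    (by simp [hx8, hs]) (by simp)

/-- Some token may be moved. -/
def unbalancedE : Expr := sum 7 (movableOfE 7)

theorem holds_unbalancedE (h : Represents G t σ) :
    unbalancedE.Holds σ ↔ ∃ s c d, IsMovable G t s c d := by
  rw [unbalancedE, holds_sum h.size]
  refine exists_congr fun d => ?_
  exact holds_movableOfE (h.setReg (by decide) _) (by decide) (by decide) (by decide) (by simp)

/-- The number of vertices with load at least that of `c`. -/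
def heavyE (c : ℕ) : Expr := count 7 (le (loadE c) (loadE 7))

theorem eval_heavyE (h : Represents G t σ) {x : ℕ} (hx : 7 < x) {c : Fin n}
    (hc : σ.reg x = c) : (heavyE x).eval σ = (heavy t c).card := by
  have hx7 : x ≠ 7 := by omega
  rw [heavyE, heavy]
  refine eval_count h.size 7 fun i => ?_
  have h' := h.setReg (x := 7) (by decide) i
  rw [holds_le, eval_loadE h' (by omega) (c := c) (by simp [hx7, hc]),
    eval_loadE h' (by omega) (c := i) (by simp)]

/-- The number of representatives all of whose neighbours have load at least that of `c`. -/
def heavyRepsE (c : ℕ) : Expr :=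
  count 7 (and (repE 7) (all 8 (imp (closedE 7 8) (le (loadE c) (loadE 8)))))

theorem eval_heavyRepsE (h : Represents G t σ) {x : ℕ} (hx : 8 < x) {c : Fin n}
    (hc : σ.reg x = c) : (heavyRepsE x).eval σ = (G.heavyReps t c).card := by
  have hx7 : x ≠ 7 := by omega
  have hx8 : x ≠ 8 := by omega
  classical
  rw [heavyRepsE, heavyReps]
  refine (eval_count h.size 7 (P := fun s => G.IsRep s ∧
    ∀ x, s = x ∨ G.Adj s x → tokenLoad t c ≤ tokenLoad t x) fun i => ?_).trans (by congr)
  have h' := h.setReg (x := 7) (by decide) i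
  rw [holds_and, holds_repE h' (by decide) (u := i) (by simp), holds_all h'.size]
  refine and_congr_right fun _ => forall_congr' fun j => ?_
  have h'' := h'.setReg (x := 8) (by decide) j
  rw [holds_imp, holds_le, holds_closedE h'' (by decide) (u := i) (v := j) (by simp) (by simp),
    eval_loadE h'' (by omega) (c := c) (by simp [hx7, hx8, hc]),
    eval_loadE h'' (by omega) (c := j) (by simp)]

/-- The ratio for `x` is at most the ratio for `y`. -/
def ratioLeE (x y : ℕ) : Expr :=
  le (mul 9 (heavyRepsE x) (heavyE y)) (mul 9 (heavyRepsE y) (heavyE x))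

theorem holds_ratioLeE (h : Represents G t σ) {x y : ℕ} (hx : 9 < x) (hy : 9 < y) {c d : Fin n}
    (hc : σ.reg x = c) (hd : σ.reg y = d) :
    (ratioLeE x y).Holds σ ↔ (G.heavyReps t c).card * (heavy t d).card ≤
      (G.heavyReps t d).card * (heavy t c).card := by
  have key : ∀ {x y : ℕ}, 9 < x → 9 < y → ∀ {c d : Fin n}, σ.reg x = c → σ.reg y = d →
      (mul 9 (heavyRepsE x) (heavyE y)).eval σ =
        (G.heavyReps t c).card * (heavy t d).card := by
    intro x y hx hy c d hc hd
    have hx9 : x ≠ 9 := by omega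
    have hy9 : y ≠ 9 := by omega
    refine eval_mul h.size (fun i => ?_) (fun i => ?_) ?_
    · exact eval_heavyRepsE (h.setReg (by decide) _) (by omega) (by simp [hx9, hc])
    · exact eval_heavyE (h.setReg (by decide) _) (by omega) (by simp [hy9, hd])
    · exact (Finset.card_le_univ _).trans_eq (Fintype.card_fin n)
  rw [ratioLeE, holds_le, key hx hy hc hd, key hy hx hd hc]

/-- A vertex with the largest ratio. -/
def bestE : Expr := find 11 12 (all 10 (ratioLeE 10 11))

theorem eval_bestE (h : Represents G t σ) (hn : 0 < n) :
    ∃ c : Fin n, bestE.eval σ = c ∧ ∀ d, (G.heavyReps t d).card * (heavy t c).card ≤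
      (G.heavyReps t c).card * (heavy t d).card := by
  have : Nonempty (Fin n) := ⟨⟨0, hn⟩⟩
  obtain ⟨c, hc, he⟩ := eval_find (e := all 10 (ratioLeE 10 11)) h.size
    (x := 11) (y := 12) (by decide) (by decide)
    (P := fun c => ∀ d, (G.heavyReps t d).card * (heavy t c).card ≤
      (G.heavyReps t c).card * (heavy t d).card) (by
      intro j i
      have h' := (h.setReg (x := 12) (by decide) j).setReg (x := 11) (by decide) i
      rw [holds_all h'.size]
      refine forall_congr' fun d => ?_
      exact holds_ratioLeE (h'.setReg (by decide) _) (by decide) (by decide) (by simp) (by simp))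
    (by
      obtain ⟨c, hc⟩ := Finite.exists_max fun c : Fin n =>
        ((G.heavyReps t c).card : ℚ) / (heavy t c).card
      refine ⟨c, fun d => ?_⟩
      have := hc d
      rw [div_le_div_iff₀ (by exact_mod_cast card_heavy_pos t d)
        (by exact_mod_cast card_heavy_pos t c)] at this
      exact_mod_cast this)
  exact ⟨c, he, hc⟩

open Classical in
/-- The number of non-neighbours of a cosimplicial vertex. -/
noncomputable def coSize (G : SimpleGraph (Fin n)) (v : Fin n) : ℕ :=
  if G.IsCosimplicial v then (Finset.univ.filter fun u => ¬ G.Adj v u).card else 0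

def coSizeE (x : ℕ) : Expr := ite (cosimplicialE x) (count 7 (not (adjE x 7))) (const 0)

theorem eval_coSizeE (h : Represents G t σ) {x : ℕ} (hx : 7 < x) {v : Fin n}
    (hv : σ.reg x = v) : (coSizeE x).eval σ = coSize G v := by
  classical
  have hx7 : x ≠ 7 := by omega
  rw [coSizeE, eval_ite, eval_count h.size (P := fun u => ¬ G.Adj v u), coSize]
  · simp only [holds_cosimplicialE h (show 4 < x by omega) hv, Expr.eval]
  · intro i
    rw [holds_not, holds_adjE (h.setReg (by decide) _) (by omega) (u := v) (v := i)
      (by simp [hx7, hv]) (by simp)]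

/-- A vertex with the largest `coSize`. -/
def bestCoE : Expr := find 11 12 (all 10 (le (coSizeE 10) (coSizeE 11)))

theorem eval_bestCoE (h : Represents G t σ) (hn : 0 < n) :
    ∃ v : Fin n, bestCoE.eval σ = v ∧ ∀ u, coSize G u ≤ coSize G v := by
  have : Nonempty (Fin n) := ⟨⟨0, hn⟩⟩
  obtain ⟨c, hc, he⟩ := eval_find (e := all 10 (le (coSizeE 10) (coSizeE 11))) h.size
    (x := 11) (y := 12) (by decide) (by decide)
    (P := fun v => ∀ u, coSize G u ≤ coSize G v) (by
      intro j i
      have h' := (h.setReg (x := 12) (by decide) j).setReg (x := 11) (by decide) i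
      rw [holds_all h'.size]
      refine forall_congr' fun d => ?_
      have h'' := h'.setReg (x := 10) (by decide) d
      rw [holds_le, eval_coSizeE h'' (by decide) (v := d) (by simp),
        eval_coSizeE h'' (by decide) (v := i) (by simp)])
    (Finite.exists_max _)
  exact ⟨c, he, hc⟩

end Expressions

end RAM

namespace RAM

open RAM.Expr SimpleGraph

section Programs

variable {n : ℕ} {G : SimpleGraph (Fin n)}

/-! ### The token loop and the final computation -/

/-- Find a movable token and record what has to be stored for moving it. -/
def findMove : List (ℕ × Expr) :=
  [(13, find 7 12 (movableOfE 7)), (14, find 8 12 (movableFromE 13 8)),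
    (15, find 9 12 (movableE 13 14 9)), (16, idxE 13 15), (17, add (load 1 (var 16)) (const 1)),
    (18, idxE 13 14), (19, add (load 2 (var 18)) (const 1))]

/-- Move one token. -/
def moveProgram : Program :=
  block 30 (.seq (.instr (.store 1 16 17)) (.seq (.instr (.store 2 18 19))
    (assign 30 20 unbalancedE))) findMove

/-- The bound on the number of steps of `moveProgram`. -/
noncomputable def moveCost : Polynomial ℕ := blockCost findMove + unbalancedE.cost + 3

/-- Compute the best ratio. -/
def findRatio : List (ℕ × Expr) :=
  [(13, bestE), (14, heavyRepsE 13), (15, heavyE 13), (16, bestCoE), (17, coSizeE 16),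
    (18, lt (mul 9 (var 14) (var 0)) (mul 9 (var 17) (var 15))),
    (14, ite (var 18) (var 17) (var 14)), (15, ite (var 18) (var 0) (var 15)),
    (18, lt (var 15) (add (var 14) (var 14))), (1, ite (var 18) (const 1) (var 15))]

/-- The program computing the tensor capacity of a splitgraph. -/
def capacityProgram : Program :=
  block 30 (.seq (.while 20 moveProgram)
    (block 30 (assign 30 0 (ite (var 18) (const 1) (var 14))) findRatio)) [(20, unbalancedE)]

/-- The running time of `capacityProgram`. -/
noncomputable def capacityCost : Polynomial ℕ :=
  blockCost [(20, unbalancedE)] + (Polynomial.X ^ 7 * (moveCost + 1) + 1) +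
    (blockCost findRatio + ((ite (var 18) (const 1) (var 14)).cost + 1))

/-- The loop invariant: the memory represents a token distribution of energy `m`, and
register `20` tells whether a token may be moved. -/
def LoopInv (G : SimpleGraph (Fin n)) (m : ℕ) (σ : State) : Prop :=
  ∃ t, Represents G t σ ∧ G.IsTokens (n ^ 3) t ∧ m = tokenEnergy t ∧
    (σ.reg 20 ≠ 0 ↔ ∃ s c d, IsMovable G t s c d)

open Classical in
theorem Represents.setCell {t : Fin n → Fin n → ℕ} {σ : State} (h : Represents G t σ)
    {s c d : Fin n} (hm : IsMovable G t s c d) :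
    Represents G (moveToken t s c d)
      ((σ.setCell 1 (n * s + d) (σ.arr 1 (n * s + d) + 1)).setCell 2 (n * s + c)
        (σ.arr 2 (n * s + c) + 1)) := by
  refine ⟨h.size, fun i j => by simpa using h.adj i j, fun s' x => ?_⟩
  have h0 := h.tok s' x
  have hidx : ∀ y : Fin n, (n * (s' : ℕ) + x = n * s + y) ↔ (s' = s ∧ x = y) := fun y =>
    ⟨index_inj, by rintro ⟨rfl, rfl⟩; rfl⟩
  simp only [State.setCell_arr, hidx, true_and, moveToken]
  norm_num
  by_cases hs : s' = s
  · subst hs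
    have h1 := hm.1
    by_cases hc : x = c
    · subst hc
      simp only [hm.ne, if_true, and_true, and_false, if_false]
      omega
    · by_cases hd : x = d
      · subst hd
        simp only [hc, if_true, if_false, true_and]
        omega
      · simp only [hc, hd, if_true, if_false, and_false]
        omega
  · simp only [hs, if_false, false_and]
    omega

/-- Three searches fix s, then c, then d; each finds a value that leaves the next search solvable.
-/
theorem findMove_spec {t : Fin n → Fin n → ℕ} {σ : State} (h : Represents G t σ)
    (hm : ∃ s c d, IsMovable G t s c d) :
    ∃ s c d, IsMovable G t s c d ∧ Represents G t (blockState findMove σ) ∧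
      (blockState findMove σ).arr = σ.arr ∧
      (blockState findMove σ).reg 16 = n * s + d ∧
      (blockState findMove σ).reg 17 = σ.arr 1 (n * s + d) + 1 ∧
      (blockState findMove σ).reg 18 = n * s + c ∧
      (blockState findMove σ).reg 19 = σ.arr 2 (n * s + c) + 1 := by
  obtain ⟨s, hs, es⟩ := eval_find (e := movableOfE 7) h.size (x := 7) (y := 12) (by decide)
    (by decide) (P := fun s => ∃ c d, IsMovable G t s c d) (fun j i =>
      holds_movableOfE ((h.setReg (by decide) _).setReg (by decide) _) (by decide) (by decide)
        (by decide) (by simp)) hm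
  have h1 := h.setReg (x := 13) (by decide) s
  obtain ⟨c, hc, ec⟩ := eval_find (e := movableFromE 13 8) h1.size (x := 8) (y := 12) (by decide)
    (by decide) (P := fun c => ∃ d, IsMovable G t s c d) (fun j i =>
      holds_movableFromE ((h1.setReg (by decide) _).setReg (by decide) _) (by decide) (by decide)
        (by decide) (by decide) (by simp) (by simp)) hs
  have h2 := h1.setReg (x := 14) (by decide) c
  obtain ⟨d, hd, ed⟩ := eval_find (e := movableE 13 14 9) h2.size (x := 9) (y := 12) (by decide)
    (by decide) (P := fun d => IsMovable G t s c d) (fun j i =>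
      holds_movableE ((h2.setReg (by decide) _).setReg (by decide) _) (by decide) (by decide)
        (by decide) (by simp) (by simp) (by simp)) hc
  have h3 := h2.setReg (x := 15) (by decide) d
  set σ₃ := ((σ.setReg 13 s).setReg 14 c).setReg 15 d with hσ₃
  have e16 : (idxE 13 15).eval σ₃ = n * s + d := by
    rw [eval_idxE h3.size (by decide)]
    simp [hσ₃]
  have h4 := h3.setReg (x := 16) (by decide) (n * s + d)
  have h5 := h4.setReg (x := 17) (by decide) (σ.arr 1 (n * s + d) + 1)
  have e18 : (idxE 13 14).eval ((σ₃.setReg 16 (n * s + d)).setReg 17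
      (σ.arr 1 (n * s + d) + 1)) = n * s + c := by
    rw [eval_idxE h5.size (by decide)]
    simp [hσ₃]
  have h6 := h5.setReg (x := 18) (by decide) (n * s + c)
  have h7 := h6.setReg (x := 19) (by decide) (σ.arr 2 (n * s + c) + 1)
  have e17 : (add (load 1 (var 16)) (const 1)).eval (σ₃.setReg 16 (n * s + d)) =
      σ.arr 1 (n * s + d) + 1 := by
    simp [Expr.eval, hσ₃]
  have e19 : (add (load 2 (var 18)) (const 1)).eval (((σ₃.setReg 16 (n * s + d)).setReg 17
      (σ.arr 1 (n * s + d) + 1)).setReg 18 (n * s + c)) = σ.arr 2 (n * s + c) + 1 := by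
    simp [Expr.eval, hσ₃]
  have hb : blockState findMove σ = (((σ₃.setReg 16 (n * s + d)).setReg 17
      (σ.arr 1 (n * s + d) + 1)).setReg 18 (n * s + c)).setReg 19
      (σ.arr 2 (n * s + c) + 1) := by
    simp only [blockState, findMove, List.foldl, es, ec, ed, ← hσ₃, e16, e17, e18, e19]
  rw [hb]
  exact ⟨s, c, d, hd, h7, rfl, by simp, by simp, by simp, by simp⟩

theorem moveProgram_runs {m : ℕ} {σ : State} (hσ : LoopInv G m σ) (h0 : σ.reg 20 ≠ 0) :
    ∃ t τ, Runs moveProgram σ t τ ∧ t ≤ moveCost.eval n ∧ ∃ m' < m, LoopInv G m' τ := by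
  obtain ⟨t, hr, ht, rfl, hf⟩ := hσ
  obtain ⟨s, c, d, hm, hr', harr, e16, e17, e18, e19⟩ := findMove_spec hr (hf.1 h0)
  obtain ⟨k, τ, hk, hkt, hQ⟩ := block_runs (d := 30) (by decide) (L := findMove) (by decide) σ
    (P := .seq (.instr (.store 1 16 17)) (.seq (.instr (.store 2 18 19))
      (assign 30 20 unbalancedE)))
    (T := unbalancedE.cost.eval n + 3)
    (Q := fun τ => ∃ m' < tokenEnergy t, LoopInv G m' τ) (by
      intro τ hτ
      set υ := (Instr.store 2 18 19).apply ((Instr.store 1 16 17).apply τ) with hυ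
      have hυ' : υ = ((τ.setCell 1 (n * s + d) (τ.arr 1 (n * s + d) + 1)).setCell 2 (n * s + c)
          (τ.arr 2 (n * s + c) + 1)) := by
        simp only [hυ, Instr.apply, State.setCell_reg, hτ.1 16 (by decide), hτ.1 17 (by decide),
          hτ.1 18 (by decide), hτ.1 19 (by decide), e16, e17, e18, e19, hτ.2, harr]
      have hυr : Represents G (moveToken t s c d) υ := by
        rw [hυ']
        exact (hτ.represents (by decide) hr').setCell hm
      obtain ⟨k, ω, hk, hkt, hω⟩ := assign_runs (d := 30) (r := 20) (by decide)
        (e := unbalancedE) (by decide) υ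
      refine ⟨_, ω, .seq (.instr _ _) (.seq (.instr _ _) hk), ?_, _, hm.energy_lt, _,
        hω.represents (by decide) (hυr.setReg (by decide) _), ht.move hm, rfl, ?_⟩
      · rw [hυr.size] at hkt
        omega
      · rw [hω.1 20 (by decide), State.setReg_reg, if_pos rfl]
        exact holds_unbalancedE hυr)
  refine ⟨k, τ, hk, ?_, hQ⟩
  rw [hr.size] at hkt
  simp only [moveCost, Polynomial.eval_add, Polynomial.eval_ofNat]
  omega

open Classical in
theorem findRatio_spec {t : Fin n → Fin n → ℕ} {σ : State} (h : Represents G t σ) (hn : 0 < n)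
    (ht : G.IsTokens (n ^ 3) t) (hst : ∀ s c d, ¬ IsMovable G t s c d)
    (hG : G.IsSplitgraph) :
    (blockState findRatio σ).reg 1 ≠ 0 ∧
    G.HasTensorCapacity (((ite (var 18) (const 1) (var 14)).eval (blockState findRatio σ) : ℝ) /
      ((blockState findRatio σ).reg 1 : ℝ)) := by
  have : Nonempty (Fin n) := ⟨⟨0, hn⟩⟩
  obtain ⟨c, ec, hc⟩ := eval_bestE h hn
  have h1 := h.setReg (x := 13) (by decide) c
  have e14 := eval_heavyRepsE h1 (x := 13) (by decide) (c := c) (by simp)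
  have h2 := h1.setReg (x := 14) (by decide) (G.heavyReps t c).card
  have e15 := eval_heavyE h2 (x := 13) (by decide) (c := c) (by simp)
  have h3 := h2.setReg (x := 15) (by decide) (heavy t c).card
  obtain ⟨v, ev, hv⟩ := eval_bestCoE h3 hn
  have h4 := h3.setReg (x := 16) (by decide) v
  have e17 := eval_coSizeE h4 (x := 16) (by decide) (v := v) (by simp)
  have h5 := h4.setReg (x := 17) (by decide) (coSize G v)
  set A := (G.heavyReps t c).card with hA
  set B := (heavy t c).card with hB
  set E := coSize G v with hE
  set σ₅ := ((((σ.setReg 13 c).setReg 14 A).setReg 15 B).setReg 16 v).setReg 17 E with hσ₅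
  have hAn : A ≤ n := (Finset.card_le_univ _).trans_eq (Fintype.card_fin n)
  have hEn : E ≤ n := by
    rw [hE, coSize]
    split_ifs
    · exact (Finset.card_le_univ _).trans_eq (Fintype.card_fin n)
    · exact Nat.zero_le n
  have m1 : (mul 9 (var 14) (var 0)).eval σ₅ = A * n :=
    eval_mul h5.size (fun i => by simp [Expr.eval, hσ₅])
      (fun i => by simp [Expr.eval, h5.size]) hAn
  have m2 : (mul 9 (var 17) (var 15)).eval σ₅ = E * B :=
    eval_mul h5.size (fun i => by simp [Expr.eval, hσ₅])
      (fun i => by simp [Expr.eval, hσ₅]) hEn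
  have hBpos : 0 < B := card_heavy_pos t c
  -- The gap vertex `c₀` is only known to exist. The program tries all vertices, and its best ratio
  -- A / B is at least that of `c₀`.
  obtain ⟨c₀, hc₀⟩ := ht.exists_heavyReps_ratio hst (by rw [Fintype.card_fin])
  have hreps : ∀ J : Finset (Fin n), (∀ v ∈ J, G.IsRep v) →
      J.card * B ≤ A * (G.closedNbhd J).card := by
    intro J hJ
    refine Nat.le_of_mul_le_mul_left ?_ (card_heavy_pos t c₀)
    calc (heavy t c₀).card * (J.card * B) = J.card * (heavy t c₀).card * B := by ring
      _ ≤ (G.heavyReps t c₀).card * (G.closedNbhd J).card * B :=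
        Nat.mul_le_mul_right _ (hc₀ J hJ)
      _ = (G.heavyReps t c₀).card * B * (G.closedNbhd J).card := by ring
      _ ≤ A * (heavy t c₀).card * (G.closedNbhd J).card := Nat.mul_le_mul_right _ (hc c₀)
      _ = _ := by ring
  have hco : ∀ u, G.IsCosimplicial u →
      (Finset.univ.filter fun w => ¬ G.Adj u w).card ≤ E := by
    intro u hu
    have := hv u
    rwa [coSize, if_pos hu] at this
  -- The larger of A / B and E / n bounds the ratio of every independent set, and some independent
  -- set attains it.
  obtain ⟨a, b, hab, hb, hJ, hI⟩ : ∃ a b : ℕ,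
      (a, b) = (if A * n < E * B then (E, n) else (A, B)) ∧ b ≠ 0 ∧
      (∀ J : Finset (Fin n), G.IsIndepSet J → J.card * b ≤ a * (G.closedNbhd J).card) ∧
      ∃ I : Finset (Fin n), G.IsIndepSet I ∧ a * (G.closedNbhd I).card ≤ I.card * b ∧
        a ≤ I.card := by
    by_cases hlt : A * n < E * B
    · refine ⟨E, n, by rw [if_pos hlt], hn.ne', fun J hJ => hJ.card_mul_le
        hG.simplicial_or_cosimplicial (fun K hK => ?_) (fun u hu => ?_), ?_⟩
      · refine Nat.le_of_mul_le_mul_left ?_ hBpos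
        calc B * (K.card * n) = K.card * B * n := by ring
          _ ≤ A * (G.closedNbhd K).card * n := Nat.mul_le_mul_right _ (hreps K hK)
          _ = A * n * (G.closedNbhd K).card := by ring
          _ ≤ E * B * (G.closedNbhd K).card := Nat.mul_le_mul_right _ hlt.le
          _ = _ := by ring
      · rw [Fintype.card_fin]
        exact Nat.mul_le_mul_right _ (hco u hu)
      -- The strict inequality forces E > 0, while `coSize` is 0 at vertices that are not
      -- cosimplicial.
      · have hvc : G.IsCosimplicial v := by
          by_contra hn'
          have : E = 0 := by rw [hE, coSize, if_neg hn']
          rw [this, zero_mul] at hlt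
          exact Nat.not_lt_zero _ hlt
        refine ⟨Finset.univ.filter fun w => ¬ G.Adj v w, isIndepSet_of_not_adj fun x hx y hy =>
          hvc x y (Finset.mem_filter.1 hx).2 (Finset.mem_filter.1 hy).2, ?_, ?_⟩
        · rw [hE, coSize, if_pos hvc]
          exact Nat.mul_le_mul_left _ ((Finset.card_le_univ _).trans_eq (Fintype.card_fin n))
        · rw [hE, coSize, if_pos hvc]
    · refine ⟨A, B, by rw [if_neg hlt], hBpos.ne', fun J hJ => hJ.card_mul_le
        hG.simplicial_or_cosimplicial hreps (fun u hu => ?_), G.heavyReps t c,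
        isIndepSet_heavyReps t c, ?_, le_rfl⟩
      · rw [Fintype.card_fin]
        exact (Nat.mul_le_mul_right _ (hco u hu)).trans (not_lt.1 hlt)
      · exact Nat.mul_le_mul_left _ (Finset.card_le_card (closedNbhd_heavyReps_subset t c))
  obtain ⟨I, hIi, hIab, hIa⟩ := hI
  -- A single vertex has positive ratio. Hence 0 < a ≤ |I|, and the extremal set is nonempty.
  have ha : a ≠ 0 := by
    rintro rfl
    have := hJ {⟨0, hn⟩} (by simp)
    simp [hb] at this
  have hcap := hasTensorCapacity_of_ratio hb hJ hIi (Finset.card_pos.1 (by omega)) hIab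
  have hout : (blockState findRatio σ).reg 1 = (if b < 2 * a then 1 else b) ∧
      (ite (var 18) (const 1) (var 14)).eval (blockState findRatio σ) =
        (if b < 2 * a then 1 else a) := by
    have hlt18 : ∀ e f : Expr, (lt e f).eval σ₅ = f.eval σ₅ - e.eval σ₅ := fun e f => rfl
    -- Five assignments lead to `σ₅`; the sixth stores E B - A n, nonzero exactly when E / n exceeds
    -- A / B.
    have hbs : blockState findRatio σ = blockState (findRatio.drop 6)
        (σ₅.setReg 18 (E * B - A * n)) := by
      simp only [blockState, findRatio, List.foldl, List.drop, ec, e14, e15, ev, e17, ← hσ₅,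
        hlt18, m1, m2]
    have hsz : σ₅.reg 0 = n := h5.size
    have h14 : σ₅.reg 14 = A := by simp [hσ₅]
    have h15 : σ₅.reg 15 = B := by simp [hσ₅]
    have h17 : σ₅.reg 17 = E := by simp [hσ₅]
    rw [hbs]
    simp only [blockState, findRatio, List.foldl, List.drop, Expr.eval, Expr.lt,
      State.setReg_reg, hsz, h14, h15, h17]
    norm_num
    by_cases hlt : A * n < E * B
    · rw [if_pos hlt, Prod.mk.injEq] at hab
      have h6 : E * B - A * n ≠ 0 := by omega
      simp only [hab.1, hab.2, h6, if_false]
      constructor <;> split_ifs <;> omega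
    · rw [if_neg hlt, Prod.mk.injEq] at hab
      have h6 : E * B - A * n = 0 := by omega
      simp only [hab.1, hab.2, h6, if_true]
      constructor <;> split_ifs <;> omega
  rw [hout.1, hout.2]
  split_ifs at hcap ⊢ with hab2
  · simpa using hcap
  · exact ⟨hb, hcap⟩

open Classical in
/-- All tokens of a representative lie on itself. -/
noncomputable def initialTokens (G : SimpleGraph (Fin n)) : Fin n → Fin n → ℕ :=
  fun s c => if s = c ∧ G.IsRep s then n ^ 3 else 0

theorem represents_graphInput : Represents G (initialTokens G) (graphInput G) := by
  classical
  refine ⟨by simp [graphInput], fun i j => ?_, fun s c => by simp [graphInput, initialTokens]⟩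
  simp only [graphInput, true_and]
  congr 1
  refine propext ⟨?_, fun h => ⟨i, j, h, by rw [mul_comm]⟩⟩
  rintro ⟨i', j', h, he⟩
  rw [mul_comm (i' : ℕ)] at he
  obtain ⟨rfl, rfl⟩ := index_inj he
  exact h

theorem isTokens_initialTokens : G.IsTokens (n ^ 3) (initialTokens G) := by
  classical
  refine ⟨fun s => ?_, fun s c h => ?_⟩
  · by_cases hs : G.IsRep s <;> simp [initialTokens, hs]
  · by_contra hc
    exact h (if_neg fun h' => hc (Or.inl h'.1))

/-- This bounds the number of rounds of the token loop. -/
theorem tokenEnergy_initialTokens_le : tokenEnergy (initialTokens G) ≤ n ^ 7 := by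
  have h1 : ∀ c, tokenLoad (initialTokens G) c ≤ n ^ 3 := by
    intro c
    calc tokenLoad (initialTokens G) c ≤ ∑ s, if s = c then n ^ 3 else 0 := by
          refine Finset.sum_le_sum fun s _ => ?_
          simp only [initialTokens]
          split_ifs with h h'
          · exact le_rfl
          · exact absurd h.1 h'
          · exact Nat.zero_le _
          · exact le_rfl
      _ = n ^ 3 := by simp
  calc tokenEnergy (initialTokens G) ≤ ∑ c : Fin n, (n ^ 3) ^ 2 :=
        Finset.sum_le_sum fun c _ => Nat.pow_le_pow_left (h1 c) 2
    _ = n ^ 7 := by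
      rw [Finset.sum_const, Finset.card_univ, Fintype.card_fin, smul_eq_mul]
      ring

/-- Register 0 holds n, the range of every sum, so the numerator is written there only by the very
last assignment. -/
theorem capacityProgram_runs (hn : 0 < n) (hG : G.IsSplitgraph) :
    ∃ t τ, Runs capacityProgram (graphInput G) t τ ∧ t ≤ capacityCost.eval n ∧
      τ.reg 1 ≠ 0 ∧ G.HasTensorCapacity ((τ.reg 0 : ℝ) / (τ.reg 1 : ℝ)) := by
  have hr := represents_graphInput (G := G)
  obtain ⟨k, τ, hk, hkt, hQ⟩ := block_runs (d := 30) (by decide) (L := [(20, unbalancedE)])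
    (by decide) (graphInput G)
    (P := .seq (.while 20 moveProgram)
      (block 30 (assign 30 0 (ite (var 18) (const 1) (var 14))) findRatio))
    (T := (n ^ 7 * (moveCost.eval n + 1) + 1) + ((blockCost findRatio).eval n +
      ((ite (var 18) (const 1) (var 14)).cost.eval n + 1)))
    (Q := fun τ => τ.reg 1 ≠ 0 ∧ G.HasTensorCapacity ((τ.reg 0 : ℝ) / (τ.reg 1 : ℝ))) (by
      intro τ hτ
      have hi : LoopInv G (tokenEnergy (initialTokens G)) τ := by
        refine ⟨_, hτ.represents (by decide) (hr.setReg (by decide) _), isTokens_initialTokens,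
          rfl, ?_⟩
        rw [hτ.1 20 (by decide)]
        exact holds_unbalancedE hr
      obtain ⟨k₁, τ₁, hk₁, hkt₁, ⟨m, t, hrt, ht, -, hf⟩, h0⟩ :=
        while_runs (LoopInv G) (fun m σ => moveProgram_runs) _ τ hi
      obtain ⟨hout, hcap⟩ := findRatio_spec hrt hn ht
        (fun s c d h => hf.2 ⟨s, c, d, h⟩ h0) hG
      obtain ⟨k₂, τ₂, hk₂, hkt₂, hQ₂⟩ := block_runs (d := 30) (by decide) (L := findRatio)
        (by decide) τ₁ (P := assign 30 0 (ite (var 18) (const 1) (var 14)))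
        (T := (ite (var 18) (const 1) (var 14)).cost.eval n + 1)
        (Q := fun τ => τ.reg 1 ≠ 0 ∧ G.HasTensorCapacity ((τ.reg 0 : ℝ) / (τ.reg 1 : ℝ))) (by
          intro υ hυ
          obtain ⟨k, ω, hk, hkt, hω⟩ := assign_runs (d := 30) (r := 0) (by decide)
            (e := ite (var 18) (const 1) (var 14)) (by decide) υ
          refine ⟨k, ω, hk, ?_, ?_⟩
          · simpa [cost] using hkt
          · rw [hω.1 1 (by decide), hω.1 0 (by decide)]
            simp only [State.setReg_reg, if_true, one_ne_zero, if_false]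
            rw [hυ.1 1 (by decide), eval_congr (d := 30) (by decide) _ (by decide) hυ]
            exact ⟨hout, hcap⟩)
      refine ⟨_, τ₂, .seq hk₁ hk₂, ?_, hQ₂⟩
      rw [hrt.size] at hkt₂
      have := Nat.mul_le_mul_right (moveCost.eval n + 1) (tokenEnergy_initialTokens_le (G := G))
      omega)
  refine ⟨k, τ, hk, ?_, hQ⟩
  rw [hr.size] at hkt
  simp only [capacityCost, Polynomial.eval_add, Polynomial.eval_mul, Polynomial.eval_pow,
    Polynomial.eval_X, Polynomial.eval_one] at hkt ⊢
  omega

end Programs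

end RAM

theorem mainTheorem7 :
    ∃ (P : RAM.Program) (p : Polynomial ℕ),
      ∀ (n : ℕ) (_ : 1 ≤ n) (G : SimpleGraph (Fin n)), G.IsSplitgraph →
        ∃ (t : ℕ) (τ : RAM.State),
          RAM.Runs P (RAM.graphInput G) t τ ∧
          t ≤ p.eval n ∧
          τ.reg 1 ≠ 0 ∧
          G.HasTensorCapacity ((τ.reg 0 : ℝ) / (τ.reg 1 : ℝ)) :=
  ⟨RAM.capacityProgram, RAM.capacityCost, fun _ hn _ hG => RAM.capacityProgram_runs hn hG⟩
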